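/- Let $N\ge 1$, let $\mathbb B_N$ be the open unit ball and $S_N$ the unit sphere of $\mathbb C^N$, $\sigma$ the normalized surface measure on $S_N$, and $\langle z,w\rangle=\sum_i z_i\overline{w_i}$. Let $H^2(\mathbb B_N)$ be the Hilbert space of holomorphic functions $f$ on $\mathbb B_N$ with $\|f\|^2=\sup_{0<r<1}\int_{S_N}|f(r\zeta)|^2\,d\sigma(\zeta)<\infty$ and inner product $\lim_{r\to1^-}\int_{S_N}f(r\zeta)\overline{g(r\zeta)}\,d\sigma(\zeta)$. Let $a_1\in\mathbb C\setminus\{0\}$, $a_0\in\mathbb B_N$, and let $A$ be a complex symmetric $N\times N$ matrix ($A^T=A$) such that $$\varphi(z)=\frac{a_0-Az}{1-\langle z,\overline{a_0}\rangle}$$ maps $\mathbb B_N$ into itself; put $\psi(z)=a_1/(1-\langle z,\overline{a_0}\rangle)^N$ and $W_{\psi,\varphi}f=\psi\cdot(f\circ\varphi)$. Here a bar over a vector or a matrix is the entrywise complex conjugate. Theorem. $W_{\psi,\varphi}$ is a unitary operator on $H^2(\mathbb B_N)$ if and only if $$a_1=\lambda(1-|a_0|^2)^{N/2}\ \text{ for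 some }\lambda\in\mathbb C\text{ with }|\lambda|=1,\qquad \overline A A-\overline{a_0}\,a_0^T=(1-|a_0|^2)I_N,\qquad A\overline{a_0}=a_0 .$$ In particular, if $a_0=0$, then $W_{\psi,\varphi}$ is unitary if and only if $\psi$ is constant on $\mathbb B_N$, equal to some $\lambda$ with $|\lambda|=1$, and $\varphi(z)=-Az$ on $\mathbb B_N$ with $A$ unitary and symmetric. -/

import Mathlib

open MeasureTheory Filter Topology
open scoped Pointwise

noncomputable section

namespace BallHardy

/-- `ℂ^N` with its Euclidean norm. -/
abbrev CN (N : ℕ) := EuclideanSpace ℂ (Fin N)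

/-- The open unit ball of `ℂ^N`, as a set. -/
abbrev ball (N : ℕ) : Set (CN N) := Metric.ball (0 : CN N) 1

/-- The unit sphere of `ℂ^N`, as a set. -/
abbrev sphere (N : ℕ) : Set (CN N) := Metric.sphere (0 : CN N) 1

/-- The normalized surface measure on the unit sphere of `ℂ^N`. -/
def sigma (N : ℕ) : Measure (sphere N) :=
  ((volume : Measure (CN N)).toSphere Set.univ)⁻¹ • (volume : Measure (CN N)).toSphere

/-- Extension by zero of a function on the ball to `ℂ^N`. -/
def ext {N : ℕ} (f : ball N → ℂ) : CN N → ℂ :=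
  Function.extend Subtype.val f 0

/-- The function `f` on the ball is holomorphic. -/
def Holo {N : ℕ} (f : ball N → ℂ) : Prop := DifferentiableOn ℂ (ext f) (ball N)

/-- The integral mean `∫_S |f(rζ)|² dσ(ζ)`. -/
def mean {N : ℕ} (f : ball N → ℂ) (r : ℝ) : ℝ :=
  ∫ ζ : sphere N, ‖ext f ((r : ℂ) • (ζ : CN N))‖ ^ 2 ∂(sigma N)

/-- The pairing `∫_S conj (f(rζ)) g(rζ) dσ(ζ)`, conjugate-linear in the first argument as is
Mathlib's `inner`. -/
def pair {N : ℕ} (f g : ball N → ℂ) (r : ℝ) : ℂ :=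
  ∫ ζ : sphere N, (starRingEnd ℂ) (ext f ((r : ℂ) • (ζ : CN N))) *
    ext g ((r : ℂ) • (ζ : CN N)) ∂(sigma N)

/-! ### Basic facts on integral means -/

lemma ext_coe {N : ℕ} (f : ball N → ℂ) (z : ball N) : ext f z = f z :=
  Subtype.val_injective.extend_apply _ _ _

lemma ext_add {N : ℕ} (f g : ball N → ℂ) : ext (f + g) = ext f + ext g := by
  have := Function.extend_add (Subtype.val : ball N → CN N) f g 0 0
  simpa [ext] using this

lemma ext_smul {N : ℕ} (c : ℂ) (f : ball N → ℂ) : ext (c • f) = c • ext f := by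
  have := Function.extend_smul c (Subtype.val : ball N → CN N) f 0
  simpa [ext] using this

lemma ext_zero {N : ℕ} : ext (0 : ball N → ℂ) = 0 := by
  have := ext_smul (0 : ℂ) (0 : ball N → ℂ)
  simpa using this

instance (N : ℕ) : IsFiniteMeasure (sigma N) := by
  refine ⟨?_⟩
  rw [sigma, Measure.smul_apply, smul_eq_mul]
  by_cases h : (volume : Measure (CN N)).toSphere Set.univ = 0
  · simp [Measure.measure_univ_eq_zero.mp h]
  · exact ENNReal.mul_lt_top (ENNReal.inv_lt_top.mpr (pos_iff_ne_zero.mpr h)) (measure_lt_top _ _)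

instance (N : ℕ) : (sigma N).IsOpenPosMeasure := by
  refine ⟨fun U hU hne => ?_⟩
  rw [sigma, Measure.smul_apply, smul_eq_mul]
  exact mul_ne_zero (ENNReal.inv_ne_zero.mpr (measure_ne_top _ _)) (hU.measure_ne_zero _ hne)

instance (N : ℕ) [NeZero N] : IsProbabilityMeasure (sigma N) := by
  refine ⟨?_⟩
  rw [sigma, Measure.smul_apply, smul_eq_mul]
  refine ENNReal.inv_mul_cancel ?_ (measure_ne_top _ _)
  rw [Ne, Measure.measure_univ_eq_zero]
  exact Measure.toSphere_ne_zero _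

/-- Rotation of the sphere by a unimodular scalar. -/
def rot {N : ℕ} (c : ℂ) (hc : ‖c‖ = 1) (ζ : sphere N) : sphere N :=
  ⟨c • (ζ : CN N), by
    have := ζ.2
    simp only [mem_sphere_zero_iff_norm] at this ⊢
    rw [norm_smul, hc, this, one_mul]⟩

lemma rot_inv {N : ℕ} {c : ℂ} (hc : ‖c‖ = 1) (hc' : ‖c⁻¹‖ = 1) (ζ : sphere N) :
    rot c hc (rot c⁻¹ hc' ζ) = ζ := by
  have h0 : c ≠ 0 := by
    rintro rfl
    simp at hc
  apply Subtype.ext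
  simp [rot, smul_smul, mul_inv_cancel₀ h0]

lemma continuous_rot {N : ℕ} {c : ℂ} (hc : ‖c‖ = 1) : Continuous (rot (N := N) c hc) := by
  unfold rot
  fun_prop

/-- Multiplication by a unimodular scalar as a homeomorphism of the sphere. -/
def rotHomeo (N : ℕ) (c : ℂ) (hc : ‖c‖ = 1) : sphere N ≃ₜ sphere N where
  toFun := rot c hc
  invFun := rot c⁻¹ (by rw [norm_inv, hc, inv_one])
  left_inv ζ := by
    have h := rot_inv (c := c⁻¹) (by rw [norm_inv, hc, inv_one]) (by rw [inv_inv, hc]) ζ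
    simpa only [inv_inv] using h
  right_inv ζ := rot_inv hc _ ζ
  continuous_toFun := continuous_rot hc
  continuous_invFun := continuous_rot _

lemma integral_rot {N : ℕ} {c : ℂ} (hc : ‖c‖ = 1) (g : sphere N → ℝ) :
    ∫ ζ, g (rot c hc ζ) ∂(sigma N) = ∫ ζ, g ζ ∂(sigma N) := by
  have hmp : MeasurePreserving (rotHomeo N c hc) (volume : Measure (CN N)).toSphere
      (volume : Measure (CN N)).toSphere := by
    refine ⟨(rotHomeo N c hc).continuous.measurable, ?_⟩
    ext s hs
    rw [Measure.map_apply (rotHomeo N c hc).continuous.measurable hs,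
      Measure.toSphere_apply' _ hs,
      Measure.toSphere_apply' _ ((rotHomeo N c hc).continuous.measurable hs)]
    congr 1
    have h0 : c ≠ 0 := by
      rintro rfl
      simp at hc
    let L : CN N ≃ₗᵢ[ℝ] CN N :=
      { toLinearEquiv := (LinearEquiv.smulOfNeZero ℂ (CN N) c h0).restrictScalars ℝ
        norm_map' := fun x => by
          change ‖c • x‖ = ‖x‖
          rw [norm_smul, hc, one_mul] }
    have hL : MeasurePreserving L (volume : Measure (CN N)) volume := L.measurePreserving
    have := hL.measure_preimage_equiv (f := L.toHomeomorph.toMeasurableEquiv)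
      (Set.Ioo (0 : ℝ) 1 • ((↑) '' s : Set (CN N)))
    rw [← this]
    congr 1
    ext x
    have hLx : ∀ y, L y = c • y := fun y => rfl
    simp only [Set.mem_smul, Set.mem_image, Set.mem_preimage]
    constructor
    · rintro ⟨r, hr, _, ⟨ζ, hζ, rfl⟩, rfl⟩
      refine ⟨r, hr, _, ⟨_, hζ, rfl⟩, ?_⟩
      change r • (c • (ζ : CN N)) = c • (r • (ζ : CN N))
      rw [smul_comm]
    · rintro ⟨r, hr, _, ⟨ζ, hζ, rfl⟩, hx⟩
      refine ⟨r, hr, _, ⟨(rotHomeo N c hc).symm ζ, by simpa using hζ, rfl⟩, ?_⟩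
      have hx' : r • (ζ : CN N) = c • x := hx
      change r • (c⁻¹ • (ζ : CN N)) = x
      rw [smul_comm, hx', inv_smul_smul₀ h0]
  have hmp' : MeasurePreserving (rotHomeo N c hc) (sigma N) (sigma N) := hmp.smul_measure _
  exact hmp'.integral_comp (rotHomeo N c hc).measurableEmbedding g

lemma smul_mem_ball {N : ℕ} {c : ℂ} (hc : ‖c‖ < 1) (ζ : sphere N) : c • (ζ : CN N) ∈ ball N := by
  have := ζ.2
  simp only [mem_sphere_zero_iff_norm] at this
  rw [mem_ball_zero_iff, norm_smul, this, mul_one]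
  exact hc

lemma continuous_slice {N : ℕ} {F : CN N → ℂ} (hF : DifferentiableOn ℂ F (ball N)) {c : ℂ}
    (hc : ‖c‖ < 1) : Continuous fun ζ : sphere N => F (c • (ζ : CN N)) :=
  hF.continuousOn.comp_continuous (by fun_prop) (fun ζ => smul_mem_ball hc ζ)

lemma integrable_of_continuous {N : ℕ} {E : Type*} [NormedAddCommGroup E] {g : sphere N → E}
    (hg : Continuous g) : Integrable g (sigma N) :=
  hg.integrable_of_hasCompactSupport (HasCompactSupport.of_compactSpace g)

lemma hasDerivAt_slice {N : ℕ} {F : CN N → ℂ} (hF : DifferentiableOn ℂ F (ball N)) {t : ℂ}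
    (ht : ‖t‖ < 1) (ζ : sphere N) :
    DifferentiableAt ℂ (fun t : ℂ => F (t • (ζ : CN N))) t := by
  have h1 : DifferentiableAt ℂ F (t • (ζ : CN N)) :=
    hF.differentiableAt (Metric.isOpen_ball.mem_nhds (smul_mem_ball ht ζ))
  exact h1.comp t (by fun_prop)

/-- Holomorphy in `t` of `∫_S G(ζ) F(tζ) dσ(ζ)`. -/
lemma differentiableOn_integral {N : ℕ} {F : CN N → ℂ} (hF : DifferentiableOn ℂ F (ball N))
    {G : sphere N → ℂ} (hG : Continuous G) :
    DifferentiableOn ℂ (fun t : ℂ => ∫ ζ : sphere N, G ζ * F (t • (ζ : CN N)) ∂(sigma N))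
      (Metric.ball 0 1) := by
  intro t₀ ht₀
  rw [mem_ball_zero_iff] at ht₀
  obtain ⟨ε, hε, hε1⟩ : ∃ ε : ℝ, 0 < ε ∧ ‖t₀‖ + 2 * ε < 1 := ⟨(1 - ‖t₀‖) / 3, by linarith, by linarith⟩
  have hK : IsCompact (Metric.closedBall (0 : CN N) (‖t₀‖ + 2 * ε)) := isCompact_closedBall _ _
  obtain ⟨C, hC⟩ := hK.exists_bound_of_continuousOn
    (hF.continuousOn.mono (Metric.closedBall_subset_ball hε1))
  have hCb : ∀ (t : ℂ) (ζ : sphere N), ‖t‖ ≤ ‖t₀‖ + 2 * ε → ‖F (t • (ζ : CN N))‖ ≤ C := by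
    intro t ζ ht
    apply hC
    have := ζ.2
    simp only [mem_sphere_zero_iff_norm] at this
    rw [mem_closedBall_zero_iff, norm_smul, this, mul_one]
    exact ht
  have hnear : ∀ t ∈ Metric.ball t₀ ε, ‖t‖ < ‖t₀‖ + ε := by
    intro t ht
    rw [mem_ball_iff_norm] at ht
    have := norm_add_le (t - t₀) t₀
    rw [sub_add_cancel] at this
    linarith
  have hd : ∀ (ζ : sphere N), ∀ t ∈ Metric.ball t₀ ε,
      HasDerivAt (fun t : ℂ => G ζ * F (t • (ζ : CN N)))
        (G ζ * deriv (fun t : ℂ => F (t • (ζ : CN N))) t) t := by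
    intro ζ t ht
    have h1 : ‖t‖ < 1 := by linarith [hnear t ht]
    exact ((hasDerivAt_slice hF h1 ζ).hasDerivAt).const_mul _
  have hmeas : ∀ t : ℂ, ‖t‖ < 1 → Continuous fun ζ : sphere N => G ζ * F (t • (ζ : CN N)) :=
    fun t ht => hG.mul (continuous_slice hF ht)
  have key := hasDerivAt_integral_of_dominated_loc_of_deriv_le (μ := sigma N)
    (F := fun (t : ℂ) (ζ : sphere N) => G ζ * F (t • (ζ : CN N)))
    (F' := fun (t : ℂ) (ζ : sphere N) => G ζ * deriv (fun t : ℂ => F (t • (ζ : CN N))) t)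
    (x₀ := t₀) (s := Metric.ball t₀ ε) (bound := fun ζ => ‖G ζ‖ * (C / ε))
    (Metric.ball_mem_nhds _ hε) ?_ ?_ ?_ ?_ ?_ ?_
  · exact key.2.differentiableAt.differentiableWithinAt
  · filter_upwards [Metric.ball_mem_nhds t₀ hε] with t ht
    exact (hmeas t (by linarith [hnear t ht])).aestronglyMeasurable
  · exact integrable_of_continuous (hmeas t₀ ht₀)
  · refine aestronglyMeasurable_of_tendsto_ae (𝓝[≠] t₀) (f := fun (t : ℂ) (ζ : sphere N) =>
      if ‖t‖ < 1 then
        slope (fun t : ℂ => G ζ * F (t • (ζ : CN N))) t₀ t else 0) ?_ ?_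
    · intro t
      split_ifs with ht
      · simp only [slope_def_module]
        exact (((hmeas t ht).sub (hmeas t₀ ht₀)).const_smul ((t - t₀)⁻¹)).aestronglyMeasurable
      · exact aestronglyMeasurable_const
    · refine Eventually.of_forall fun ζ => ?_
      have h1 := (hd ζ t₀ (Metric.mem_ball_self hε)).tendsto_slope
      refine h1.congr' ?_
      filter_upwards [mem_nhdsWithin_of_mem_nhds (Metric.ball_mem_nhds t₀ hε)] with t ht
      rw [if_pos (by linarith [hnear t ht])]
  · refine Eventually.of_forall fun ζ t ht => ?_
    rw [norm_mul]
    refine mul_le_mul_of_nonneg_left ?_ (norm_nonneg _)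
    have hsub : ∀ w ∈ Metric.closedBall t ε, ‖w‖ ≤ ‖t₀‖ + 2 * ε := by
      intro w hw
      rw [mem_closedBall_iff_norm] at hw
      have := norm_add_le (w - t) t
      rw [sub_add_cancel] at this
      linarith [hnear t ht]
    refine Complex.norm_deriv_le_of_forall_mem_sphere_norm_le hε ?_ ?_
    · refine DifferentiableOn.diffContOnCl (fun w hw => ?_)
      have hw' := hsub w (Metric.closure_ball_subset_closedBall hw)
      exact (hasDerivAt_slice hF (by linarith) ζ).differentiableWithinAt
    · intro w hw
      exact hCb w ζ (hsub w (Metric.sphere_subset_closedBall hw))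
  · exact integrable_of_continuous (by fun_prop)
  · exact Eventually.of_forall fun ζ t ht => hd ζ t ht

lemma mean_nonneg {N : ℕ} (f : ball N → ℂ) (r : ℝ) : 0 ≤ mean f r :=
  integral_nonneg fun _ => by positivity

lemma norm_ofReal_lt {r : ℝ} (h0 : 0 ≤ r) (h1 : r < 1) : ‖(r : ℂ)‖ < 1 := by
  rwa [Complex.norm_real, Real.norm_of_nonneg h0]

/-- The integral means of a holomorphic function increase with the radius. -/
lemma mean_mono {N : ℕ} {f : ball N → ℂ} (hf : Holo f) {r s : ℝ} (hr : 0 < r) (hrs : r ≤ s)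
    (hs : s < 1) : mean f r ≤ mean f s := by
  have hs0 : 0 < s := hr.trans_le hrs
  have hrn : ‖(r : ℂ)‖ < 1 := norm_ofReal_lt hr.le (hrs.trans_lt hs)
  have hsn : ‖(s : ℂ)‖ < 1 := norm_ofReal_lt hs0.le hs
  have cr := continuous_slice hf hrn
  set h : ℂ → ℂ := fun t => ∫ ζ : sphere N,
    (starRingEnd ℂ) (ext f ((r : ℂ) • (ζ : CN N))) * ext f (t • (ζ : CN N)) ∂(sigma N) with hh
  have hd : DifferentiableOn ℂ h (Metric.ball 0 1) :=
    differentiableOn_integral hf (Complex.continuous_conj.comp cr)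
  have hbd : ∀ t ∈ frontier (Metric.ball (0 : ℂ) s), ‖h t‖ ≤ (mean f r + mean f s) / 2 := by
    intro t ht
    rw [frontier_ball _ hs0.ne', mem_sphere_zero_iff_norm] at ht
    have ct := continuous_slice hf (c := t) (by rw [ht]; exact hs)
    have hc : ‖t / s‖ = 1 := by
      rw [norm_div, ht, Complex.norm_real, Real.norm_of_nonneg hs0.le, div_self hs0.ne']
    have hms : mean f s = ∫ ζ : sphere N, ‖ext f (t • (ζ : CN N))‖ ^ 2 ∂(sigma N) := by
      rw [mean, ← integral_rot hc]
      refine integral_congr_ae (Eventually.of_forall fun ζ => ?_)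
      have : (s : ℂ) ≠ 0 := by exact_mod_cast hs0.ne'
      simp only [rot, smul_smul, mul_div_cancel₀ _ this]
    rw [hms, mean, ← integral_add (integrable_of_continuous (by fun_prop))
      (integrable_of_continuous (by fun_prop)), ← integral_div]
    refine norm_integral_le_of_norm_le (integrable_of_continuous (by fun_prop))
      (Eventually.of_forall fun ζ => ?_)
    rw [norm_mul, RCLike.norm_conj]
    nlinarith [sq_nonneg (‖ext f ((r : ℂ) • (ζ : CN N))‖ - ‖ext f (t • (ζ : CN N))‖)]
  have hle := Complex.norm_le_of_forall_mem_frontier_norm_le (U := Metric.ball (0 : ℂ) s)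
    Metric.isBounded_ball (DifferentiableOn.diffContOnCl
      (hd.mono (Metric.closure_ball_subset_closedBall.trans (Metric.closedBall_subset_ball hs))))
    hbd (z := (r : ℂ)) (by
      rw [closure_ball _ hs0.ne', mem_closedBall_zero_iff, Complex.norm_real,
        Real.norm_of_nonneg hr.le]
      exact hrs)
  have hhr : h r = (mean f r : ℂ) := by
    rw [hh, mean, ← integral_complex_ofReal]
    refine integral_congr_ae (Eventually.of_forall fun ζ => ?_)
    simp only [Complex.ofReal_pow]
    rw [mul_comm, Complex.mul_conj']
  rw [hhr, Complex.norm_real, Real.norm_of_nonneg (mean_nonneg f r)] at hle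
  linarith

lemma mean_add_le {N : ℕ} {f g : ball N → ℂ} (hf : Holo f) (hg : Holo g) {r : ℝ} (h0 : 0 < r)
    (h1 : r < 1) : mean (f + g) r ≤ 2 * mean f r + 2 * mean g r := by
  have cf := continuous_slice hf (norm_ofReal_lt h0.le h1)
  have cg := continuous_slice hg (norm_ofReal_lt h0.le h1)
  unfold mean
  rw [ext_add, ← integral_const_mul, ← integral_const_mul,
    ← integral_add (integrable_of_continuous (by fun_prop))
      (integrable_of_continuous (by fun_prop))]
  refine integral_mono (integrable_of_continuous ?_) (integrable_of_continuous (by fun_prop))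
    fun ζ => ?_
  · simp only [Pi.add_apply]
    fun_prop
  · simp only [Pi.add_apply]
    have := norm_add_le (ext f ((r : ℂ) • (ζ : CN N))) (ext g ((r : ℂ) • (ζ : CN N)))
    have h3 := norm_nonneg (ext f ((r : ℂ) • (ζ : CN N)) + ext g ((r : ℂ) • (ζ : CN N)))
    nlinarith [sq_nonneg (‖ext f ((r : ℂ) • (ζ : CN N))‖ - ‖ext g ((r : ℂ) • (ζ : CN N))‖)]

lemma mean_smul {N : ℕ} (c : ℂ) (f : ball N → ℂ) (r : ℝ) : mean (c • f) r = ‖c‖ ^ 2 * mean f r := by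
  unfold mean
  rw [ext_smul, ← integral_const_mul]
  simp only [Pi.smul_apply, norm_smul, mul_pow]

lemma Holo.add {N : ℕ} {f g : ball N → ℂ} (hf : Holo f) (hg : Holo g) : Holo (f + g) := by
  unfold Holo
  rw [ext_add]
  exact DifferentiableOn.add hf hg

lemma Holo.smul {N : ℕ} (c : ℂ) {f : ball N → ℂ} (hf : Holo f) : Holo (c • f) := by
  unfold Holo
  rw [ext_smul]
  exact DifferentiableOn.const_smul hf c

/-! ### The Hardy space -/

/-- The Hardy space `H²` of the unit ball of `ℂ^N`: holomorphic functions on the ball with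
`sup_{0<r<1} ∫_S |f(rζ)|² dσ(ζ) < ∞`. -/
def hardySubmodule (N : ℕ) : Submodule ℂ (ball N → ℂ) where
  carrier := {f | Holo f ∧ BddAbove ((fun r => mean f r) '' Set.Ioo (0 : ℝ) 1)}
  zero_mem' := by
    refine ⟨?_, ⟨0, ?_⟩⟩
    · unfold Holo
      rw [ext_zero]
      exact differentiableOn_const (0 : ℂ)
    · rintro _ ⟨r, -, rfl⟩
      simp [mean, ext_zero]
  add_mem' := by
    rintro f g ⟨hf, A, hA⟩ ⟨hg, B, hB⟩
    refine ⟨hf.add hg, 2 * A + 2 * B, ?_⟩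
    rintro _ ⟨r, hr, rfl⟩
    have h1 := hA ⟨r, hr, rfl⟩
    have h2 := hB ⟨r, hr, rfl⟩
    have h3 := mean_add_le hf hg hr.1 hr.2
    simp only at h1 h2 ⊢
    linarith
  smul_mem' := by
    rintro c f ⟨hf, A, hA⟩
    refine ⟨hf.smul c, ‖c‖ ^ 2 * A, ?_⟩
    rintro _ ⟨r, hr, rfl⟩
    have h1 := hA ⟨r, hr, rfl⟩
    simp only at h1 ⊢
    rw [mean_smul]
    gcongr

/-- The Hardy space `H²` as a type. -/
def H2 (N : ℕ) : Type := hardySubmodule N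

instance (N : ℕ) : AddCommGroup (H2 N) := inferInstanceAs (AddCommGroup (hardySubmodule N))

instance (N : ℕ) : Module ℂ (H2 N) := inferInstanceAs (Module ℂ (hardySubmodule N))

instance (N : ℕ) : CoeOut (H2 N) (ball N → ℂ) := ⟨fun f => f.1⟩

lemma tendsto_mean {N : ℕ} (f : H2 N) :
    Tendsto (mean (f : ball N → ℂ)) (𝓝[<] 1)
      (𝓝 (sSup ((fun r => mean (f : ball N → ℂ) r) '' Set.Ioo (0 : ℝ) 1))) := by
  have hm : MonotoneOn (mean (f : ball N → ℂ)) (Set.Ioo (0 : ℝ) 1) :=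
    fun r hr s hs hrs => mean_mono f.2.1 hr.1 hrs hs.2
  exact hm.tendsto_nhdsWithin_Ioo_left (Set.nonempty_Ioo.mpr zero_lt_one) f.2.2

lemma eventually_Ioo : ∀ᶠ r : ℝ in 𝓝[<] 1, r ∈ Set.Ioo (0 : ℝ) 1 :=
  Ioo_mem_nhdsLT zero_lt_one

lemma pair_polarization {N : ℕ} {f g : ball N → ℂ} (hf : Holo f) (hg : Holo g) {r : ℝ}
    (hr : r ∈ Set.Ioo (0 : ℝ) 1) :
    pair f g r = ((mean (f + g) r : ℂ) - (mean (f + (-1 : ℂ) • g) r : ℂ)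
      - Complex.I * (mean (f + Complex.I • g) r : ℂ)
      + Complex.I * (mean (f + (-Complex.I) • g) r : ℂ)) / 4 := by
  have cf := continuous_slice hf (norm_ofReal_lt hr.1.le hr.2)
  have cg := continuous_slice hg (norm_ofReal_lt hr.1.le hr.2)
  have hc : ∀ c : ℂ, (mean (f + c • g) r : ℂ) = ∫ ζ : sphere N,
      (starRingEnd ℂ) (ext f ((r : ℂ) • (ζ : CN N)) + c * ext g ((r : ℂ) • (ζ : CN N))) *
        (ext f ((r : ℂ) • (ζ : CN N)) + c * ext g ((r : ℂ) • (ζ : CN N))) ∂(sigma N) := by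
    intro c
    rw [mean, ← integral_complex_ofReal]
    refine integral_congr_ae (Eventually.of_forall fun ζ => ?_)
    simp only [Complex.ofReal_pow, ext_add, ext_smul, Pi.add_apply, Pi.smul_apply, smul_eq_mul]
    rw [← Complex.mul_conj']
    ring
  have hi : ∀ c : ℂ, Integrable (fun ζ : sphere N =>
      (starRingEnd ℂ) (ext f ((r : ℂ) • (ζ : CN N)) + c * ext g ((r : ℂ) • (ζ : CN N))) *
        (ext f ((r : ℂ) • (ζ : CN N)) + c * ext g ((r : ℂ) • (ζ : CN N)))) (sigma N) := by
    intro c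
    apply integrable_of_continuous
    exact (Complex.continuous_conj.comp (by fun_prop)).mul (by fun_prop)
  have h1 := hc 1
  rw [one_smul] at h1
  have e1 := integral_sub (hi 1) (hi (-1))
  have e2 := integral_sub ((hi 1).sub (hi (-1))) ((hi Complex.I).const_mul Complex.I)
  have e3 := integral_add (((hi 1).sub (hi (-1))).sub ((hi Complex.I).const_mul Complex.I))
    ((hi (-Complex.I)).const_mul Complex.I)
  simp only [Pi.sub_apply] at e2 e3
  rw [h1, hc, hc, hc, ← integral_const_mul, ← integral_const_mul, ← e1, ← e2]
  rw [← e3, ← integral_div, pair]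
  refine integral_congr_ae (Eventually.of_forall fun ζ => ?_)
  simp only [map_add, map_mul, map_neg, map_one, Complex.conj_I]
  ring_nf
  simp only [Complex.I_sq]
  ring

/-- The radial limit that defines the inner product of `H²` exists. -/
lemma exists_tendsto_pair {N : ℕ} (f g : H2 N) :
    ∃ c : ℂ, Tendsto (pair (f : ball N → ℂ) (g : ball N → ℂ)) (𝓝[<] 1) (𝓝 c) := by
  have hT : ∀ c : ℂ, ∃ m : ℂ, Tendsto (fun r => (mean ((f : ball N → ℂ) + c • (g : ball N → ℂ)) r : ℂ))
      (𝓝[<] 1) (𝓝 m) := fun c =>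
    ⟨_, (Complex.continuous_ofReal.tendsto _).comp (tendsto_mean (f + c • g))⟩
  obtain ⟨m1, h1⟩ := hT 1
  obtain ⟨m2, h2⟩ := hT (-1)
  obtain ⟨m3, h3⟩ := hT Complex.I
  obtain ⟨m4, h4⟩ := hT (-Complex.I)
  rw [one_smul] at h1
  refine ⟨_, Tendsto.congr' ?_
    ((((h1.sub h2).sub (h3.const_mul Complex.I)).add (h4.const_mul Complex.I)).div_const 4)⟩
  filter_upwards [eventually_Ioo] with r hr
  exact (pair_polarization f.2.1 g.2.1 hr).symm

/-- The inner product of `H²`, conjugate-linear in the first argument as in Mathlib: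
`lim_{r → 1⁻} ∫_S conj (f(rζ)) g(rζ) dσ(ζ)`. -/
def innerH2 {N : ℕ} (f g : H2 N) : ℂ :=
  limUnder (𝓝[<] (1 : ℝ)) (pair (f : ball N → ℂ) (g : ball N → ℂ))

lemma tendsto_pair {N : ℕ} (f g : H2 N) :
    Tendsto (pair (f : ball N → ℂ) (g : ball N → ℂ)) (𝓝[<] 1) (𝓝 (innerH2 f g)) :=
  tendsto_nhds_limUnder (exists_tendsto_pair f g)

lemma pair_self {N : ℕ} (f : ball N → ℂ) (r : ℝ) : pair f f r = (mean f r : ℂ) := by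
  rw [pair, mean, ← integral_complex_ofReal]
  refine integral_congr_ae (Eventually.of_forall fun ζ => ?_)
  simp only [Complex.ofReal_pow]
  rw [mul_comm, Complex.mul_conj']

lemma innerH2_self {N : ℕ} (f : H2 N) :
    innerH2 f f = (sSup ((fun r => mean (f : ball N → ℂ) r) '' Set.Ioo (0 : ℝ) 1) : ℝ) := by
  refine tendsto_nhds_unique (tendsto_pair f f) ?_
  have : pair (f : ball N → ℂ) (f : ball N → ℂ) = fun r => (mean (f : ball N → ℂ) r : ℂ) :=
    funext fun r => pair_self _ r
  rw [this]
  exact (Complex.continuous_ofReal.tendsto _).comp (tendsto_mean f)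

lemma eq_zero_of_mean {N : ℕ} [NeZero N] {f : ball N → ℂ} (hf : Holo f)
    (h : ∀ r ∈ Set.Ioo (0 : ℝ) 1, mean f r = 0) : f = 0 := by
  have hne : ∀ z ∈ ball N, z ≠ 0 → ext f z = 0 := by
    intro z hz hz0
    have hr : ‖z‖ ∈ Set.Ioo (0 : ℝ) 1 := ⟨norm_pos_iff.mpr hz0, mem_ball_zero_iff.mp hz⟩
    have c := continuous_slice hf (norm_ofReal_lt hr.1.le hr.2)
    have h0 := h _ hr
    rw [mean, integral_eq_zero_iff_of_nonneg (fun _ => by positivity)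
      (integrable_of_continuous (by fun_prop))] at h0
    have h1 := (Continuous.ae_eq_iff_eq (sigma N) (by fun_prop) continuous_const).mp h0
    have hn : ((‖z‖ : ℝ) : ℂ) ≠ 0 := by exact_mod_cast hr.1.ne'
    have h2 := congrFun h1 ⟨((‖z‖ : ℝ) : ℂ)⁻¹ • z, by
      rw [mem_sphere_zero_iff_norm, norm_smul, norm_inv, Complex.norm_real, norm_norm,
        inv_mul_cancel₀ hr.1.ne']⟩
    simp only [smul_smul, mul_inv_cancel₀ hn, one_smul] at h2
    exact norm_eq_zero.mp (pow_eq_zero_iff two_ne_zero |>.mp h2)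
  have h0 : ext f 0 = 0 := by
    have hc : ContinuousAt (ext f) 0 :=
      hf.continuousOn.continuousAt (Metric.ball_mem_nhds 0 zero_lt_one)
    have : (𝓝[≠] (0 : CN N)).NeBot := Module.punctured_nhds_neBot ℂ (CN N) 0
    refine tendsto_nhds_unique (l := 𝓝[≠] (0 : CN N)) (hc.tendsto.mono_left nhdsWithin_le_nhds) ?_
    refine Tendsto.congr' ?_ (tendsto_const_nhds (x := (0 : ℂ)))
    filter_upwards [mem_nhdsWithin_of_mem_nhds (Metric.ball_mem_nhds (0 : CN N) zero_lt_one),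
      self_mem_nhdsWithin] with z hz hz0
    exact (hne z hz hz0).symm
  funext z
  rw [← ext_coe f z, Pi.zero_apply]
  by_cases hz : (z : CN N) = 0
  · rw [hz, h0]
  · exact hne z z.2 hz

/-- The inner product structure of `H²`. -/
@[reducible] def coreH2 (N : ℕ) [NeZero N] : InnerProductSpace.Core ℂ (H2 N) where
  inner f g := innerH2 f g
  conj_inner_symm f g := by
    refine tendsto_nhds_unique ((Complex.continuous_conj.tendsto _).comp (tendsto_pair g f))
      ((tendsto_pair f g).congr fun r => ?_)
    simp only [Function.comp_apply, pair]
    rw [← integral_conj]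
    simp only [map_mul, Complex.conj_conj, mul_comm]
  re_inner_nonneg f := by
    rw [innerH2_self, RCLike.re_to_complex, Complex.ofReal_re]
    apply Real.sSup_nonneg
    rintro _ ⟨r, -, rfl⟩
    exact mean_nonneg _ r
  add_left f g k := by
    refine tendsto_nhds_unique (tendsto_pair (f + g) k)
      (((tendsto_pair f k).add (tendsto_pair g k)).congr' ?_)
    filter_upwards [eventually_Ioo] with r hr
    have cf := continuous_slice f.2.1 (norm_ofReal_lt hr.1.le hr.2)
    have cg := continuous_slice g.2.1 (norm_ofReal_lt hr.1.le hr.2)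
    have ck := continuous_slice k.2.1 (norm_ofReal_lt hr.1.le hr.2)
    have e := integral_add
      (integrable_of_continuous ((Complex.continuous_conj.comp cf).mul ck))
      (integrable_of_continuous ((Complex.continuous_conj.comp cg).mul ck))
    refine e.symm.trans ?_
    refine integral_congr_ae (Eventually.of_forall fun ζ => ?_)
    change _ = (starRingEnd ℂ) (ext ((f : ball N → ℂ) + (g : ball N → ℂ)) _) * _
    simp only [ext_add, Pi.add_apply, map_add, add_mul, Function.comp_apply, Pi.mul_apply]
  smul_left f g c := by
    refine tendsto_nhds_unique (tendsto_pair (c • f) g)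
      (((tendsto_pair f g).const_mul ((starRingEnd ℂ) c)).congr fun r => ?_)
    unfold pair
    rw [← integral_const_mul]
    refine integral_congr_ae (Eventually.of_forall fun ζ => ?_)
    change _ = (starRingEnd ℂ) (ext (c • (f : ball N → ℂ)) _) * _
    simp only [ext_smul, Pi.smul_apply, smul_eq_mul, map_mul, mul_assoc]
  definite f hf := by
    have hf' : innerH2 f f = 0 := hf
    rw [innerH2_self, Complex.ofReal_eq_zero] at hf'
    apply Subtype.ext
    refine eq_zero_of_mean f.2.1 fun r hr => ?_
    refine le_antisymm ?_ (mean_nonneg _ _)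
    rw [← hf']
    exact le_csSup f.2.2 ⟨r, hr, rfl⟩

instance instNormedAddCommGroupH2 (N : ℕ) [NeZero N] : NormedAddCommGroup (H2 N) :=
  (coreH2 N).toNormedAddCommGroup

instance instInnerProductSpaceH2 (N : ℕ) [NeZero N] : InnerProductSpace ℂ (H2 N) :=
  InnerProductSpace.ofCore (coreH2 N).toCore

lemma norm_sq_H2 {N : ℕ} [NeZero N] (f : H2 N) :
    ‖f‖ ^ 2 = sSup ((fun r => mean (f : ball N → ℂ) r) '' Set.Ioo (0 : ℝ) 1) := by
  have h : (inner ℂ f f : ℂ) = innerH2 f f := rfl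
  have h2 := inner_self_eq_norm_sq_to_K (𝕜 := ℂ) f
  rw [h, innerH2_self] at h2
  apply Complex.ofReal_injective
  rw [h2]
  simp

/-! ### Weighted composition operators -/

/-- The weighted composition `f ↦ ψ · (f ∘ φ)` on functions on the ball. -/
def weightedComp {N : ℕ} (ψ : ball N → ℂ) (φ : ball N → ball N) (f : ball N → ℂ) : ball N → ℂ :=
  fun z => ψ z * f (φ z)

/-- The weighted composition operator with weight `ψ` and symbol `φ` is a unitary operator on `H²`:
it maps `H²` to `H²`, where it is a surjective linear isometry. -/
def IsUnitaryOnH2 {N : ℕ} [NeZero N] (ψ : ball N → ℂ) (φ : ball N → ball N) : Prop :=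
  ∃ U : H2 N ≃ₗᵢ[ℂ] H2 N, ∀ f : H2 N, (U f : ball N → ℂ) = weightedComp ψ φ f

/-- The entrywise complex conjugate of a vector. -/
def conjVec {N : ℕ} (a : CN N) : CN N := WithLp.toLp 2 fun i => (starRingEnd ℂ) (a i)

/-- `ψ(z) = a₁ / (1 - ⟨z, conj a₀⟩)^N`. Here `⟨z, w⟩ = ∑ zᵢ conj wᵢ` is Mathlib's
`inner ℂ w z`. -/
def psi {N : ℕ} (a₁ : ℂ) (a₀ : CN N) (z : CN N) : ℂ :=
  a₁ / (1 - inner ℂ (conjVec a₀) z) ^ N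

/-- `φ(z) = (a₀ - A z) / (1 - ⟨z, conj a₀⟩)`. -/
def phi {N : ℕ} (a₀ : CN N) (A : Matrix (Fin N) (Fin N) ℂ) (z : CN N) : CN N :=
  (1 - inner ℂ (conjVec a₀) z)⁻¹ • (a₀ - Matrix.toEuclideanLin A z)

end BallHardy

end

noncomputable section

namespace BallHardy

/-! ### Invariance of the surface measure -/

/-! The space `H2 N` is a reproducing kernel Hilbert space with the Cauchy–Szegő kernel `K_w(z) = (1
- ⟨z, w⟩)^{-N}`. The adjoint of a weighted composition operator sends `K_w` to `conj (ψ w) • K_{φ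
w}`. A unitary one therefore satisfies `ψ(z) conj(ψ(w)) K_{φ(w)}(φ(z)) = K_w(z)`. Conversely, this
identity says that two families of vectors have the same Gram matrix; if `φ` is onto and `ψ` has no
zero, both families span densely and the operator is unitary (`szego_identity_of_isUnitary`,
`isUnitary_of_szego_identity`).

For the given symbols the powers of the denominators cancel, and the identity becomes `autNum(w,
z)^N = |a₁|² (1 - ⟨z, w⟩)^N`, where `autNum` is the numerator of `1 - ⟨φ(z), φ(w)⟩`, of degree at
most one in `z` and in `conj w`. The origin gives `|a₁|² = (1 - |a₀|²)^N`. The derivative along `z ↦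
t z` at `t = 0` removes the `N`-th power and gives the two relations on `a₀` and `A`
(`autRel_of_autNum`). Conversely, these relations give `autNum = (1 - |a₀|²)(1 - ⟨z, w⟩)` and an
explicit inverse of `φ` (`AutRel.autNum_eq`, `AutRel.phi_phi`).

The analytic input is the reproducing property (`integral_szego`, `inner_kerFun`). It comes from
unitary invariance of `σ` and the moments of one coordinate, which are the reciprocals of the Taylor
coefficients of `(1 - x)^{-N}` (`choose_mul_moment`). Completeness of `H2 N` serves the density
argument and the extension of the isometry. -/

/-- A real-linear isometry of `ℂ^N` as a homeomorphism of the unit sphere. -/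
def sphereHomeo {N : ℕ} (L : CN N ≃ₗᵢ[ℝ] CN N) : sphere N ≃ₜ sphere N :=
  L.toHomeomorph.subtype fun x => by simp

lemma sphereHomeo_symm_coe {N : ℕ} (L : CN N ≃ₗᵢ[ℝ] CN N) (ζ : sphere N) :
    ((sphereHomeo L).symm ζ : CN N) = L.symm ζ := rfl

/-- The surface measure of a set is a constant times the volume of the cone `(0, 1) • s` over it; a
linear isometry preserves volume and commutes with forming cones. -/
lemma measurePreserving_sphereHomeo {N : ℕ} (L : CN N ≃ₗᵢ[ℝ] CN N) :
    MeasurePreserving (sphereHomeo L) (sigma N) (sigma N) := by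
  have hmp : MeasurePreserving (sphereHomeo L) (volume : Measure (CN N)).toSphere
      (volume : Measure (CN N)).toSphere := by
    refine ⟨(sphereHomeo L).continuous.measurable, ?_⟩
    ext s hs
    rw [Measure.map_apply (sphereHomeo L).continuous.measurable hs,
      Measure.toSphere_apply' _ hs,
      Measure.toSphere_apply' _ ((sphereHomeo L).continuous.measurable hs)]
    congr 1
    have hL : MeasurePreserving L (volume : Measure (CN N)) volume := L.measurePreserving
    have := hL.measure_preimage_equiv (f := L.toHomeomorph.toMeasurableEquiv)
      (Set.Ioo (0 : ℝ) 1 • ((↑) '' s : Set (CN N)))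
    rw [← this]
    congr 1
    ext x
    simp only [Set.mem_smul, Set.mem_image, Set.mem_preimage]
    constructor
    · rintro ⟨r, hr, _, ⟨ζ, hζ, rfl⟩, rfl⟩
      exact ⟨r, hr, _, ⟨_, hζ, rfl⟩, (map_smul L r (ζ : CN N)).symm⟩
    · rintro ⟨r, hr, _, ⟨ζ, hζ, rfl⟩, hx⟩
      refine ⟨r, hr, _, ⟨(sphereHomeo L).symm ζ, by simpa using hζ, rfl⟩, ?_⟩
      have hx' : r • (ζ : CN N) = L x := hx
      rw [sphereHomeo_symm_coe, ← map_smul, hx', L.symm_apply_apply]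
  exact hmp.smul_measure _

lemma integral_comp_isometry {N : ℕ} {E : Type*} [NormedAddCommGroup E] [NormedSpace ℝ E]
    (L : CN N ≃ₗᵢ[ℝ] CN N) (F : CN N → E) :
    ∫ ζ : sphere N, F (L ζ) ∂(sigma N) = ∫ ζ : sphere N, F ζ ∂(sigma N) :=
  (measurePreserving_sphereHomeo L).integral_comp (sphereHomeo L).measurableEmbedding
    (fun ζ : sphere N => F ζ)

/-- A function that an isometry multiplies by a constant `c ≠ 1` has vanishing integral. -/
lemma integral_eq_zero_of_isometry {N : ℕ} (L : CN N ≃ₗᵢ[ℝ] CN N) {F : CN N → ℂ} {c : ℂ}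
    (hc : c ≠ 1) (h : ∀ z, F (L z) = c * F z) : ∫ ζ : sphere N, F ζ ∂(sigma N) = 0 := by
  have h1 := integral_comp_isometry L F
  simp only [h] at h1
  rw [integral_const_mul] at h1
  have h2 : (c - 1) * ∫ ζ : sphere N, F ζ ∂(sigma N) = 0 := by rw [sub_mul, h1]; ring
  exact (mul_eq_zero.mp h2).resolve_left (sub_ne_zero.mpr hc)

/-- The diagonal isometry with unimodular entries `u`. -/
def diagIso {N : ℕ} (u : Fin N → Circle) : CN N ≃ₗᵢ[ℝ] CN N :=
  LinearIsometryEquiv.piLpCongrRight 2 fun i => rotation (u i)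

lemma diagIso_apply {N : ℕ} (u : Fin N → Circle) (z : CN N) (i : Fin N) :
    diagIso u z i = u i * z i := rfl

/-- The point `e^i` has infinite order because `π` is irrational. A single rotation of this kind
then separates all pairs of monomials of different degree. -/
lemma exists_circle_pow_ne : ∃ u : Circle, ∀ j k : ℕ, j ≠ k → u ^ j ≠ u ^ k := by
  refine ⟨Circle.exp 1, fun j k hjk h => ?_⟩
  have hp : ∀ n : ℕ, (Circle.exp 1) ^ n = Circle.exp n := by
    intro n
    induction n with
    | zero => simp
    | succ n ih => rw [pow_succ, ih, Nat.cast_succ, Circle.exp_add]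
  rw [hp, hp, Circle.exp_eq_exp] at h
  obtain ⟨m, hm⟩ := h
  by_cases hm0 : m = 0
  · subst hm0
    simp at hm
    exact hjk hm
  · have hm' : (m : ℝ) ≠ 0 := by exact_mod_cast hm0
    refine irrational_pi ⟨((j : ℚ) - k) / (2 * m), ?_⟩
    push_cast
    field_simp
    linarith

lemma circle_pow_mul_conj_pow_ne_one {u : Circle} {j k : ℕ} (h : u ^ j ≠ u ^ k) :
    (u : ℂ) ^ j * (starRingEnd ℂ) (u : ℂ) ^ k ≠ 1 := by
  intro h1
  apply h
  apply Circle.ext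
  have h2 : (u : ℂ) ^ k * (starRingEnd ℂ) (u : ℂ) ^ k = 1 := by
    rw [← mul_pow, Complex.mul_conj, Circle.normSq_coe]
    simp
  have h3 : (starRingEnd ℂ) (u : ℂ) ^ k ≠ 0 := right_ne_zero_of_mul_eq_one h2
  push_cast
  exact mul_right_cancel₀ h3 (h1.trans h2.symm)

lemma norm_coord_le {N : ℕ} (ζ : sphere N) (i : Fin N) : ‖(ζ : CN N) i‖ ≤ 1 := by
  have h := ζ.2
  rw [mem_sphere_zero_iff_norm] at h
  rw [← h]
  exact PiLp.norm_apply_le _ i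

/-! ### Moments of the first coordinate -/

lemma integral_coord_pow_eq_zero {N : ℕ} (i : Fin N) {j k : ℕ} (hjk : j ≠ k) :
    ∫ ζ : sphere N, ((ζ : CN N) i) ^ j * (starRingEnd ℂ) ((ζ : CN N) i) ^ k ∂(sigma N) = 0 := by
  obtain ⟨u, hu⟩ := exists_circle_pow_ne
  refine integral_eq_zero_of_isometry (F := fun z : CN N => z i ^ j * (starRingEnd ℂ) (z i) ^ k)
    (diagIso fun _ => u) (circle_pow_mul_conj_pow_ne_one (hu j k hjk)) fun z => ?_
  simp only [diagIso_apply, map_mul]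
  ring

/-- The moment `∫_S |ζ₀|^{2k} dσ`. -/
def moment (N : ℕ) [NeZero N] (k : ℕ) : ℂ :=
  ∫ ζ : sphere N, ((ζ : CN N) 0) ^ k * (starRingEnd ℂ) ((ζ : CN N) 0) ^ k ∂(sigma N)

/-- The point of `ℂ^N` with coordinate `z i` kept at `i = 0` and multiplied by `t` elsewhere. -/
def stretch {N : ℕ} [NeZero N] (t : ℂ) (z : CN N) : CN N :=
  WithLp.toLp 2 fun i => if i = 0 then z i else t * z i

lemma norm_stretch_le {N : ℕ} [NeZero N] {t : ℂ} (ht : ‖t‖ ≤ 1) (z : CN N) :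
    ‖stretch t z‖ ≤ ‖z‖ := by
  rw [EuclideanSpace.norm_eq, EuclideanSpace.norm_eq]
  refine Real.sqrt_le_sqrt (Finset.sum_le_sum fun i _ => ?_)
  simp only [stretch]
  split_ifs
  · exact le_rfl
  · rw [norm_mul]
    have := norm_nonneg (z i)
    gcongr
    nlinarith

lemma continuous_stretch {N : ℕ} [NeZero N] :
    Continuous fun p : ℂ × CN N => stretch p.1 p.2 := by
  unfold stretch
  refine (PiLp.continuous_toLp 2 _).comp (continuous_pi fun i => ?_)
  split_ifs <;> fun_prop

lemma stretch_zero {N : ℕ} [NeZero N] (z : CN N) :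
    stretch 0 z = z 0 • EuclideanSpace.single (0 : Fin N) (1 : ℂ) := by
  ext i
  by_cases h : i = 0
  · subst h
    simp [stretch]
  · simp [stretch, h]

lemma differentiable_stretch {N : ℕ} [NeZero N] (z : CN N) :
    Differentiable ℂ fun t : ℂ => stretch t z := by
  have : (fun t : ℂ => stretch t z) =
      fun t => stretch 0 z + t • (z - stretch 0 z) := by
    funext t
    ext i
    by_cases h : i = 0
    · simp [stretch, h]
    · simp [stretch, h]
  rw [this]
  fun_prop

/-- Integration over the sphere of a holomorphic function times a function of the first coordinate
only sees the restriction of the holomorphic function to the first coordinate axis. -/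
lemma integral_slice {N : ℕ} [NeZero N] {F : CN N → ℂ} (hF : DifferentiableOn ℂ F (ball N))
    {r : ℝ} (h0 : 0 ≤ r) (h1 : r < 1) {G : ℂ → ℂ} (hG : Continuous G) :
    ∫ ζ : sphere N, F ((r : ℂ) • (ζ : CN N)) * G ((ζ : CN N) 0) ∂(sigma N) =
      ∫ ζ : sphere N, F (((r : ℂ) * (ζ : CN N) 0) • EuclideanSpace.single (0 : Fin N) (1 : ℂ)) *
        G ((ζ : CN N) 0) ∂(sigma N) := by
  -- For `|t| = 1` the map `stretch t` is a diagonal unitary fixing the first coordinate, so the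
  -- integral of `H t` over the sphere does not depend on `t` (`hconst`). For fixed `ζ`, the
  -- function `t ↦ H t ζ` is holomorphic, so its circle average is `H 0 ζ` (`hmean`). Fubini
  -- combines the two.
  set H : ℂ → sphere N → ℂ := fun t ζ =>
    F ((r : ℂ) • stretch t (ζ : CN N)) * G ((ζ : CN N) 0) with hH
  have hball : ∀ (t : ℂ) (ζ : sphere N), ‖t‖ ≤ 1 →
      (r : ℂ) • stretch t (ζ : CN N) ∈ Metric.closedBall (0 : CN N) r := by
    intro t ζ ht
    rw [mem_closedBall_zero_iff, norm_smul, Complex.norm_real, Real.norm_of_nonneg h0]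
    have h2 := norm_stretch_le ht (ζ : CN N)
    have h3 := ζ.2
    rw [mem_sphere_zero_iff_norm] at h3
    rw [h3] at h2
    nlinarith
  have hsub : Metric.closedBall (0 : CN N) r ⊆ ball N := Metric.closedBall_subset_ball h1
  have hconst : ∀ θ : ℝ, ∫ ζ, H (circleMap 0 1 θ) ζ ∂(sigma N) =
      ∫ ζ : sphere N, F ((r : ℂ) • (ζ : CN N)) * G ((ζ : CN N) 0) ∂(sigma N) := by
    intro θ
    rw [← integral_comp_isometry (diagIso fun i => if i = 0 then 1 else Circle.exp θ)
      (fun z => F ((r : ℂ) • z) * G (z 0))]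
    refine integral_congr_ae (Eventually.of_forall fun ζ => ?_)
    have e : stretch (circleMap 0 1 θ) (ζ : CN N) =
        diagIso (fun i => if i = 0 then 1 else Circle.exp θ) (ζ : CN N) := by
      ext i
      rw [diagIso_apply]
      simp only [stretch]
      split_ifs <;> simp [circleMap]
    have e0 : diagIso (fun i => if i = 0 then 1 else Circle.exp θ) (ζ : CN N) 0 =
        (ζ : CN N) 0 := by simp [diagIso_apply]
    simp only [hH, e, e0]
  have hmean : ∀ ζ : sphere N, Real.circleAverage (fun t => H t ζ) 0 1 = H 0 ζ := by
    intro ζ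
    refine circleAverage_of_differentiable_on_off_countable Set.countable_empty ?_ ?_
    · refine ContinuousOn.mul (hF.continuousOn.comp ?_ fun t ht => hsub (hball t ζ ?_))
        continuousOn_const
      · have := (differentiable_stretch (ζ : CN N)).continuous
        fun_prop
      · simpa using ht
    · rintro t ⟨ht, -⟩
      have ht' : ‖t‖ ≤ 1 := by
        simp at ht
        exact ht.le
      have hd : DifferentiableAt ℂ F ((r : ℂ) • stretch t (ζ : CN N)) :=
        hF.differentiableAt (Metric.isOpen_ball.mem_nhds (hsub (hball t ζ ht')))
      exact (hd.comp t ((differentiable_stretch (ζ : CN N)).differentiableAt.const_smul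
        (r : ℂ))).mul_const _
  have hcont : Continuous fun p : ℝ × sphere N => H (circleMap 0 1 p.1) p.2 := by
    refine Continuous.mul (hF.continuousOn.comp_continuous ?_ fun p =>
      hsub (hball _ _ (by simp [circleMap]))) (hG.comp (by fun_prop))
    have := continuous_stretch.comp (((continuous_circleMap 0 1).comp continuous_fst).prodMk
      ((continuous_subtype_val (p := fun x => x ∈ sphere N)).comp continuous_snd))
    exact (continuous_const (y := (r : ℂ))).smul this
  have hint : Integrable (Function.uncurry fun (θ : ℝ) (ζ : sphere N) => H (circleMap 0 1 θ) ζ)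
      ((volume.restrict (Set.uIoc 0 (2 * Real.pi))).prod (sigma N)) := by
    obtain ⟨C, hC⟩ := (isCompact_closedBall (0 : CN N) r).exists_bound_of_continuousOn
      (hF.continuousOn.mono hsub)
    obtain ⟨D, hD⟩ := (isCompact_closedBall (0 : ℂ) 1).exists_bound_of_continuousOn
      hG.continuousOn
    have : IsFiniteMeasure (volume.restrict (Set.uIoc 0 (2 * Real.pi))) := by
      rw [Set.uIoc_of_le (by positivity)]
      infer_instance
    refine Integrable.of_bound hcont.aestronglyMeasurable (C * D)
      (Eventually.of_forall fun p => ?_)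
    simp only [Function.uncurry, hH, norm_mul]
    have e1 := hC _ (hball (circleMap 0 1 p.1) p.2 (by simp [circleMap]))
    have e2 := hD ((p.2 : CN N) 0) (by simpa using norm_coord_le p.2 0)
    exact mul_le_mul e1 e2 (norm_nonneg _) ((norm_nonneg _).trans e1)
  have hswap := intervalIntegral_integral_swap hint
  simp only [hconst, intervalIntegral.integral_const] at hswap
  have h2 : ∫ ζ : sphere N, H 0 ζ ∂(sigma N) =
      (2 * Real.pi)⁻¹ • ∫ ζ : sphere N, (∫ θ in (0 : ℝ)..2 * Real.pi, H (circleMap 0 1 θ) ζ)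
        ∂(sigma N) := by
    rw [← integral_smul]
    refine integral_congr_ae (Eventually.of_forall fun ζ => ?_)
    exact (hmean ζ).symm
  rw [← hswap, sub_zero, smul_smul, inv_mul_cancel₀ (by positivity), one_smul] at h2
  rw [← h2]
  refine integral_congr_ae (Eventually.of_forall fun ζ => ?_)
  simp only [hH, stretch_zero, smul_smul]

/-- The integral of a holomorphic function against a power of the conjugate first coordinate. -/
lemma integral_mul_conj_pow {N : ℕ} [NeZero N] {F : CN N → ℂ}
    (hF : DifferentiableOn ℂ F (ball N)) {b : ℕ → ℂ}
    (hb : ∀ t : ℂ, ‖t‖ < 1 →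
      HasSum (fun n => b n * t ^ n) (F (t • EuclideanSpace.single (0 : Fin N) (1 : ℂ))))
    {r : ℝ} (h0 : 0 ≤ r) (h1 : r < 1) (k : ℕ) :
    ∫ ζ : sphere N, F ((r : ℂ) • (ζ : CN N)) * (starRingEnd ℂ) ((ζ : CN N) 0) ^ k ∂(sigma N) =
      b k * (r : ℂ) ^ k * moment N k := by
  rw [integral_slice hF h0 h1 (G := fun x => (starRingEnd ℂ) x ^ k)
    (Complex.continuous_conj.pow k)]
  have hrn := norm_ofReal_lt h0 h1
  have hlt : ∀ ζ : sphere N, ‖(r : ℂ) * (ζ : CN N) 0‖ < 1 := by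
    intro ζ
    rw [norm_mul]
    have := norm_coord_le ζ 0
    have := norm_nonneg (r : ℂ)
    nlinarith
  set T : ℕ → sphere N → ℂ := fun n ζ => b n * ((r : ℂ) * (ζ : CN N) 0) ^ n *
    (starRingEnd ℂ) ((ζ : CN N) 0) ^ k with hT
  have hTc : ∀ n, Continuous (T n) := by
    intro n
    have hc : Continuous fun ζ : sphere N => (ζ : CN N) 0 := by fun_prop
    exact ((continuous_const.mul ((continuous_const.mul hc).pow n)).mul
      ((Complex.continuous_conj.comp hc).pow k))
  have hsum := hasSum_integral_of_summable_integral_norm (μ := sigma N) (F := T)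
    (fun n => integrable_of_continuous (hTc n)) (by
      refine Summable.of_nonneg_of_le (fun n => integral_nonneg fun _ => norm_nonneg _)
        (fun n => ?_) ((hb r hrn).summable.norm)
      have : ∫ ζ : sphere N, ‖T n ζ‖ ∂(sigma N) ≤ ∫ ζ : sphere N, ‖b n * (r : ℂ) ^ n‖ ∂(sigma N) := by
        refine integral_mono (integrable_of_continuous (hTc n).norm) (integrable_const _) fun ζ => ?_
        have e1 := norm_coord_le ζ 0
        simp only [hT, norm_mul, norm_pow, mul_pow, RCLike.norm_conj]
        have e2 : ‖(ζ : CN N) 0‖ ^ n ≤ 1 := pow_le_one₀ (norm_nonneg _) e1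
        have e3 : ‖(ζ : CN N) 0‖ ^ k ≤ 1 := pow_le_one₀ (norm_nonneg _) e1
        have e4 : 0 ≤ ‖b n‖ * ‖(r : ℂ)‖ ^ n := by positivity
        calc ‖b n‖ * (‖(r : ℂ)‖ ^ n * ‖(ζ : CN N) 0‖ ^ n) * ‖(ζ : CN N) 0‖ ^ k
            = ‖b n‖ * ‖(r : ℂ)‖ ^ n * (‖(ζ : CN N) 0‖ ^ n * ‖(ζ : CN N) 0‖ ^ k) := by ring
          _ ≤ ‖b n‖ * ‖(r : ℂ)‖ ^ n * 1 := by
            refine mul_le_mul_of_nonneg_left (mul_le_one₀ e2 (by positivity) e3) e4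
          _ = _ := mul_one _
      simpa using this)
  -- Different powers of the first coordinate are orthogonal, so only the `k`-th Taylor term
  -- survives.
  have hI : ∀ n, ∫ ζ, T n ζ ∂(sigma N) = if n = k then b k * (r : ℂ) ^ k * moment N k else 0 := by
    intro n
    have : ∀ ζ, T n ζ = b n * (r : ℂ) ^ n * (((ζ : CN N) 0) ^ n *
        (starRingEnd ℂ) ((ζ : CN N) 0) ^ k) := by
      intro ζ
      simp only [hT]
      ring
    simp only [this]
    rw [integral_const_mul]
    split_ifs with h
    · subst h
      rfl
    · rw [integral_coord_pow_eq_zero 0 h, mul_zero]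
  simp only [hI] at hsum
  have e := hsum.unique (hasSum_ite_eq k _)
  rw [← e]
  refine integral_congr_ae (Eventually.of_forall fun ζ => ?_)
  exact (((hb _ (hlt ζ)).mul_right _).tsum_eq).symm

/-! ### Unitary changes of variable and the moment recurrence -/

/-- A complex-linear isometry regarded as a real-linear one. -/
def realIso {N : ℕ} (L : CN N ≃ₗᵢ[ℂ] CN N) : CN N ≃ₗᵢ[ℝ] CN N where
  toLinearEquiv := L.toLinearEquiv.restrictScalars ℝ
  norm_map' := L.norm_map

lemma integral_comp_unitary {N : ℕ} (L : CN N ≃ₗᵢ[ℂ] CN N) (F : CN N → ℂ) :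
    ∫ ζ : sphere N, F (L ζ) ∂(sigma N) = ∫ ζ : sphere N, F ζ ∂(sigma N) :=
  integral_comp_isometry (realIso L) F

/-- Every unit vector is the image of the first basis vector under a unitary map. -/
lemma exists_unitary_apply_single {N : ℕ} [NeZero N] {v : CN N} (hv : ‖v‖ = 1) :
    ∃ L : CN N ≃ₗᵢ[ℂ] CN N, L (EuclideanSpace.single (0 : Fin N) (1 : ℂ)) = v := by
  obtain ⟨b, hb⟩ := Orthonormal.exists_orthonormalBasis_extension_of_card_eq (𝕜 := ℂ)
    (E := CN N) (ι := Fin N) (by simp) (v := fun _ => v) (s := {0}) (by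
      rw [orthonormal_iff_ite]
      rintro ⟨i, hi⟩ ⟨j, hj⟩
      simp only [Set.mem_singleton_iff] at hi hj
      subst hi hj
      simp [inner_self_eq_norm_sq_to_K, hv])
  refine ⟨b.repr.symm, ?_⟩
  rw [OrthonormalBasis.repr_symm_single, hb 0 rfl]

lemma integrable_coord_pow {N : ℕ} (i j : Fin N) (a b c d : ℕ) :
    Integrable (fun ζ : sphere N => (ζ : CN N) i ^ a * (ζ : CN N) j ^ b *
      ((starRingEnd ℂ) ((ζ : CN N) i) ^ c * (starRingEnd ℂ) ((ζ : CN N) j) ^ d)) (sigma N) := by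
  have hi : Continuous fun ζ : sphere N => (ζ : CN N) i := by fun_prop
  have hj : Continuous fun ζ : sphere N => (ζ : CN N) j := by fun_prop
  exact integrable_of_continuous (((hi.pow a).mul (hj.pow b)).mul
    (((Complex.continuous_conj.comp hi).pow c).mul ((Complex.continuous_conj.comp hj).pow d)))

lemma integral_mixed_eq_zero {N : ℕ} {i j : Fin N} (hij : j ≠ i) (a b c d : ℕ) (hbd : b ≠ d) :
    ∫ ζ : sphere N, (ζ : CN N) i ^ a * (ζ : CN N) j ^ b *
      ((starRingEnd ℂ) ((ζ : CN N) i) ^ c * (starRingEnd ℂ) ((ζ : CN N) j) ^ d) ∂(sigma N) = 0 := by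
  obtain ⟨u, hu⟩ := exists_circle_pow_ne
  refine integral_eq_zero_of_isometry
    (F := fun z : CN N => z i ^ a * z j ^ b * ((starRingEnd ℂ) (z i) ^ c * (starRingEnd ℂ) (z j) ^ d))
    (diagIso fun l => if l = j then u else 1) (circle_pow_mul_conj_pow_ne_one (hu b d hbd))
    fun z => ?_
  simp only [diagIso_apply, map_mul, if_true, if_neg hij.symm, Circle.coe_one, map_one]
  ring

/-- Let `L` be unitary with `L e₀ = (e₀ + eᵢ)/√2`. The integral of `(Lz)₀^k (Lz)ᵢ conj(z₀)^{k+1}` is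
computed twice. Only the restriction of the holomorphic factor to the first axis matters, which
produces `moment N (k + 1)`. The substitution of `z` for `L z` turns `z₀` into `(z₀ + zᵢ)/√2`, and
in the binomial expansion only the term with `k` factors `conj z₀` survives. -/
lemma moment_succ_eq {N : ℕ} [NeZero N] {i : Fin N} (hi : i ≠ 0) (k : ℕ) :
    ((k : ℂ) + 1) * ∫ ζ : sphere N, (ζ : CN N) 0 ^ k * (ζ : CN N) i ^ 1 *
      ((starRingEnd ℂ) ((ζ : CN N) 0) ^ k * (starRingEnd ℂ) ((ζ : CN N) i) ^ 1) ∂(sigma N) =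
    moment N (k + 1) := by
  set s : ℂ := ((√2 : ℝ) : ℂ)⁻¹ with hs
  have hs0 : s ≠ 0 := by
    rw [hs]
    simp
  have hsc : (starRingEnd ℂ) s = s := by rw [hs, map_inv₀, Complex.conj_ofReal]
  set v : CN N := s • (EuclideanSpace.single 0 1 + EuclideanSpace.single i 1) with hvdef
  have hv0 : v 0 = s := by simp [hvdef, hi.symm]
  have hvi : v i = s := by simp [hvdef, hi]
  have hin : ∀ z : CN N, inner ℂ v z = s * (z 0 + z i) := by
    intro z
    rw [hvdef, inner_smul_left, inner_add_left, EuclideanSpace.inner_single_left,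
      EuclideanSpace.inner_single_left, hsc]
    simp
  have hv : ‖v‖ = 1 := by
    have h1 := inner_self_eq_norm_sq_to_K (𝕜 := ℂ) v
    rw [hin, hv0, hvi] at h1
    have h2 : s * (s + s) = 1 := by
      have : (((√2 : ℝ) : ℂ)) ^ 2 = 2 := by
        rw [← Complex.ofReal_pow, Real.sq_sqrt (by norm_num)]
        simp
      rw [← two_mul, hs, ← this]
      have h3 : (((√2 : ℝ) : ℂ)) ≠ 0 := by simp
      field_simp
    rw [h2] at h1
    have h4 : ‖v‖ ^ 2 = 1 := by
      have : (1 : ℂ) = ((‖v‖ ^ 2 : ℝ) : ℂ) := by simpa using h1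
      exact_mod_cast this.symm
    exact (pow_eq_one_iff_of_nonneg (norm_nonneg v) two_ne_zero).mp h4
  obtain ⟨L, hL⟩ := exists_unitary_apply_single hv
  have hL0 : ∀ z : CN N, s * (L z 0 + L z i) = z 0 := by
    intro z
    rw [← hin, ← hL, L.inner_map_map, EuclideanSpace.inner_single_left]
    simp
  have hd : Differentiable ℂ fun z : CN N => L z 0 ^ k * L z i ^ 1 := by
    have hc : ∀ j, Differentiable ℂ fun z : CN N => L z j := fun j =>
      (EuclideanSpace.proj (𝕜 := ℂ) j).differentiable.comp
        L.toContinuousLinearEquiv.differentiable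
    exact ((hc 0).pow k).mul ((hc i).pow 1)
  -- On the axis the holomorphic factor is `(s t)^{k+1}`, so it has a single Taylor coefficient. The
  -- radius `1/2` is arbitrary in `(0, 1)` and cancels later.
  have key := integral_mul_conj_pow hd.differentiableOn
    (b := fun n => if n = k + 1 then s ^ (k + 1) else 0) (r := 1 / 2) (by
      intro t ht
      rw [map_smul, hL]
      simp only [PiLp.smul_apply, hv0, hvi, smul_eq_mul]
      convert hasSum_ite_eq (k + 1) (s ^ (k + 1) * t ^ (k + 1)) using 1
      · funext n
        split_ifs with h
        · rw [h]
        · simp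
      · ring) (by norm_num) (by norm_num) (k + 1)
  simp only [if_true, map_smul, PiLp.smul_apply, smul_eq_mul] at key
  have e1 : ∫ ζ : sphere N, (((1 / 2 : ℝ) : ℂ) * L ζ 0) ^ k * (((1 / 2 : ℝ) : ℂ) * L ζ i) ^ 1 *
      (starRingEnd ℂ) ((ζ : CN N) 0) ^ (k + 1) ∂(sigma N) =
      s ^ (k + 1) * (((1 / 2 : ℝ) : ℂ)) ^ (k + 1) *
      ∫ ζ : sphere N, (L ζ 0) ^ k * (L ζ i) ^ 1 *
        ((starRingEnd ℂ) (L ζ 0) + (starRingEnd ℂ) (L ζ i)) ^ (k + 1) ∂(sigma N) := by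
    rw [← integral_const_mul]
    refine integral_congr_ae (Eventually.of_forall fun ζ => ?_)
    simp only
    rw [← hL0 ζ, map_mul, hsc, map_add, mul_pow, mul_pow, mul_pow]
    ring
  rw [e1, integral_comp_unitary L (fun z : CN N =>
    z 0 ^ k * z i ^ 1 * ((starRingEnd ℂ) (z 0) + (starRingEnd ℂ) (z i)) ^ (k + 1))] at key
  have h5 : s ^ (k + 1) * (((1 / 2 : ℝ) : ℂ)) ^ (k + 1) ≠ 0 :=
    mul_ne_zero (pow_ne_zero _ hs0) (pow_ne_zero _ (by simp))
  rw [← mul_left_cancel₀ h5 key]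
  simp only [add_pow, Finset.mul_sum]
  have e2 : ∀ (ζ : sphere N) (m : ℕ), (ζ : CN N) 0 ^ k * (ζ : CN N) i ^ 1 *
      ((starRingEnd ℂ) ((ζ : CN N) 0) ^ m * (starRingEnd ℂ) ((ζ : CN N) i) ^ (k + 1 - m) *
        ((k + 1).choose m : ℂ)) = ((k + 1).choose m : ℂ) * ((ζ : CN N) 0 ^ k * (ζ : CN N) i ^ 1 *
      ((starRingEnd ℂ) ((ζ : CN N) 0) ^ m * (starRingEnd ℂ) ((ζ : CN N) i) ^ (k + 1 - m))) := by
    intro ζ m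
    ring
  simp only [e2]
  rw [integral_finsetSum _ fun m _ => (integrable_coord_pow 0 i k 1 m (k + 1 - m)).const_mul _]
  simp only [integral_const_mul]
  rw [Finset.sum_eq_single k]
  · simp
  · intro m hm hmk
    rw [integral_mixed_eq_zero hi, mul_zero]
    have := Finset.mem_range.mp hm
    omega
  · simp

lemma sum_coord_mul_conj {N : ℕ} (ζ : sphere N) :
    ∑ i, (ζ : CN N) i * (starRingEnd ℂ) ((ζ : CN N) i) = 1 := by
  have h := ζ.2
  rw [mem_sphere_zero_iff_norm] at h
  have h2 := EuclideanSpace.norm_sq_eq (ζ : CN N)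
  rw [h, one_pow] at h2
  simp only [Complex.mul_conj']
  exact_mod_cast h2.symm

/-- Insert `∑ |ζᵢ|² = 1` into the moment. After multiplication by `k + 1`, each of the `N - 1`
indices `i ≠ 0` contributes one copy of the next moment, and `i = 0` contributes `k + 1` copies. -/
lemma moment_recurrence {N : ℕ} [NeZero N] (k : ℕ) :
    ((k : ℂ) + 1) * moment N k = ((k : ℂ) + N) * moment N (k + 1) := by
  have h1 : moment N k = ∑ i, ∫ ζ : sphere N, (ζ : CN N) 0 ^ k * (ζ : CN N) i ^ 1 *
      ((starRingEnd ℂ) ((ζ : CN N) 0) ^ k * (starRingEnd ℂ) ((ζ : CN N) i) ^ 1) ∂(sigma N) := by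
    rw [← integral_finsetSum _ fun i _ => integrable_coord_pow 0 i k 1 k 1]
    refine integral_congr_ae (Eventually.of_forall fun ζ => ?_)
    simp only
    rw [← mul_one ((ζ : CN N) 0 ^ k * (starRingEnd ℂ) ((ζ : CN N) 0) ^ k),
      ← sum_coord_mul_conj ζ, Finset.mul_sum]
    refine Finset.sum_congr rfl fun i _ => ?_
    ring
  have h2 : ∀ i : Fin N, ((k : ℂ) + 1) * ∫ ζ : sphere N, (ζ : CN N) 0 ^ k * (ζ : CN N) i ^ 1 *
      ((starRingEnd ℂ) ((ζ : CN N) 0) ^ k * (starRingEnd ℂ) ((ζ : CN N) i) ^ 1) ∂(sigma N) =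
      moment N (k + 1) + if i = 0 then (k : ℂ) * moment N (k + 1) else 0 := by
    intro i
    split_ifs with h
    · subst h
      have : moment N (k + 1) = ∫ ζ : sphere N, (ζ : CN N) 0 ^ k * (ζ : CN N) 0 ^ 1 *
        ((starRingEnd ℂ) ((ζ : CN N) 0) ^ k * (starRingEnd ℂ) ((ζ : CN N) 0) ^ 1) ∂(sigma N) := by
        refine integral_congr_ae (Eventually.of_forall fun ζ => ?_)
        simp only
        ring
      rw [← this]
      ring
    · rw [moment_succ_eq h, add_zero]
  rw [h1, Finset.mul_sum]
  simp only [h2]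
  rw [Finset.sum_add_distrib]
  simp
  ring

lemma moment_zero (N : ℕ) [NeZero N] : moment N 0 = 1 := by
  simp [moment]

/-- The binomial coefficient is the `k`-th Taylor coefficient of `(1 - x)^{-(n+1)}`. That it cancels
the moment is what makes the Szegő kernel reproducing. -/
lemma choose_mul_moment (n k : ℕ) :
    ((k + n).choose n : ℂ) * moment (n + 1) k = 1 := by
  induction k with
  | zero => simp [moment_zero]
  | succ k ih =>
    have h1 := moment_recurrence (N := n + 1) k
    have h2 : ((k + n + 1 : ℕ) : ℂ) * ((k + n).choose n : ℂ) =
        ((k + 1 + n).choose n : ℂ) * ((k : ℂ) + 1) := by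
      have h3 := Nat.add_one_mul_choose_eq (k + n) k
      have e1 : (k + n).choose k = (k + n).choose n := Nat.choose_symm_add
      have e2 : (k + n + 1).choose (k + 1) = (k + 1 + n).choose n := by
        rw [show k + n + 1 = k + 1 + n by ring]
        exact Nat.choose_symm_add
      rw [e1, e2] at h3
      exact_mod_cast h3
    push_cast at h1 h2
    have h4 : ((k : ℂ) + 1) ≠ 0 := by exact_mod_cast k.succ_ne_zero
    apply mul_left_cancel₀ h4
    linear_combination ((k : ℂ) + 1) * ih - ((k + n).choose n : ℂ) * h1 -
      moment (n + 1) (k + 1) * h2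

/-! ### The Cauchy–Szegő kernel -/

/-- The Cauchy–Szegő kernel `(1 - ⟨z, w⟩)^{-N}`. -/
def szego {N : ℕ} (w z : CN N) : ℂ := ((1 - inner ℂ w z) ^ N)⁻¹

/-- For `w` on the first axis the kernel is a power series in `conj ζ₀`. Termwise integration leaves
the Taylor series of `F` along the axis, because the kernel coefficients cancel the moments. The
factor `r ^ 2` appears since kernel and function are both evaluated at `rζ`. -/
lemma integral_szego_axis {N : ℕ} [NeZero N] {F : CN N → ℂ} (hF : DifferentiableOn ℂ F (ball N))
    {s : ℝ} (hs0 : 0 ≤ s) (hs1 : s < 1) {r : ℝ} (h0 : 0 ≤ r) (h1 : r < 1) :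
    ∫ ζ : sphere N, (starRingEnd ℂ) (szego ((s : ℂ) • EuclideanSpace.single (0 : Fin N) (1 : ℂ))
      ((r : ℂ) • (ζ : CN N))) * F ((r : ℂ) • (ζ : CN N)) ∂(sigma N) =
    F (((r : ℂ) ^ 2 * s) • EuclideanSpace.single (0 : Fin N) (1 : ℂ)) := by
  obtain ⟨n, rfl⟩ : ∃ n, N = n + 1 := Nat.exists_eq_succ_of_ne_zero (NeZero.ne N)
  set e : CN (n + 1) := EuclideanSpace.single (0 : Fin (n + 1)) (1 : ℂ) with he
  have henorm : ‖e‖ = 1 := by simp [he]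
  have hdh : DifferentiableOn ℂ (fun t : ℂ => F (t • e)) (Metric.ball 0 1) := by
    refine hF.comp (by fun_prop) fun t ht => ?_
    rw [mem_ball_zero_iff] at ht ⊢
    rwa [norm_smul, henorm, mul_one]
  set b : ℕ → ℂ := fun k => (k.factorial : ℂ)⁻¹ * iteratedDeriv k (fun t : ℂ => F (t • e)) 0 with hbdef
  have hb : ∀ t : ℂ, ‖t‖ < 1 → HasSum (fun k => b k * t ^ k) (F (t • e)) := by
    intro t ht
    have := Complex.hasSum_taylorSeries_on_ball hdh (z := t) (by rwa [mem_ball_zero_iff])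
    have e1 : (fun k => b k * t ^ k) = fun k : ℕ => (k.factorial : ℂ)⁻¹ • (t - 0) ^ k •
        iteratedDeriv k (fun t : ℂ => F (t • e)) 0 := by
      funext k
      simp only [hbdef, sub_zero, smul_eq_mul]
      ring
    rw [e1]
    exact this
  set q : sphere (n + 1) → ℂ := fun ζ => (starRingEnd ℂ) ((s : ℂ) * ((r : ℂ) * (ζ : CN (n + 1)) 0))
    with hq
  have hrs : r * s < 1 := by nlinarith
  have hqn : ∀ ζ, ‖q ζ‖ ≤ r * s := by
    intro ζ
    have := norm_coord_le ζ 0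
    simp only [hq, RCLike.norm_conj, norm_mul, Complex.norm_real, Real.norm_of_nonneg hs0,
      Real.norm_of_nonneg h0]
    calc s * (r * ‖(ζ : CN (n + 1)) 0‖) ≤ s * (r * 1) := by gcongr
      _ = r * s := by ring
  have hker : ∀ ζ : sphere (n + 1), HasSum (fun k => ((k + n).choose n : ℂ) * q ζ ^ k)
      ((starRingEnd ℂ) (szego ((s : ℂ) • e) ((r : ℂ) • (ζ : CN (n + 1))))) := by
    intro ζ
    have h2 := hasSum_choose_mul_geometric_of_norm_lt_one n (r := q ζ) ((hqn ζ).trans_lt hrs)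
    have e1 : (starRingEnd ℂ) (szego ((s : ℂ) • e) ((r : ℂ) • (ζ : CN (n + 1)))) =
        1 / (1 - q ζ) ^ (n + 1) := by
      simp only [szego, hq, he, inner_smul_left, inner_smul_right, EuclideanSpace.inner_single_left,
        Complex.conj_ofReal, map_inv₀, map_pow, map_sub, map_one, map_mul, one_div, one_mul]
      rw [mul_left_comm]
    rw [e1]
    exact h2
  have hFc := continuous_slice hF (norm_ofReal_lt h0 h1)
  have hqc : Continuous q := by
    simp only [hq]
    exact Complex.continuous_conj.comp (by fun_prop)
  set T : ℕ → sphere (n + 1) → ℂ := fun k ζ =>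
    ((k + n).choose n : ℂ) * q ζ ^ k * F ((r : ℂ) • (ζ : CN (n + 1))) with hT
  have hTc : ∀ k, Continuous (T k) := fun k => (continuous_const.mul (hqc.pow k)).mul hFc
  -- `C` bounds `F` on the sphere of radius `r`, and `|q| ≤ r s < 1`; together they dominate the
  -- series and justify termwise integration.
  obtain ⟨C, hC⟩ := (isCompact_univ (X := sphere (n + 1))).exists_bound_of_continuousOn
    hFc.continuousOn
  have hgeo : Summable fun k : ℕ => ((k + n).choose n : ℝ) * (r * s) ^ k :=
    summable_choose_mul_geometric_of_norm_lt_one n (by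
      rwa [Real.norm_of_nonneg (mul_nonneg h0 hs0)])
  have hsum := hasSum_integral_of_summable_integral_norm (μ := sigma (n + 1)) (F := T)
    (fun k => integrable_of_continuous (hTc k)) (by
      refine Summable.of_nonneg_of_le (fun k => integral_nonneg fun _ => norm_nonneg _)
        (fun k => ?_) (hgeo.mul_right C)
      have : ∫ ζ, ‖T k ζ‖ ∂(sigma (n + 1)) ≤
          ∫ _ζ : sphere (n + 1), ((k + n).choose n : ℝ) * (r * s) ^ k * C ∂(sigma (n + 1)) := by
        refine integral_mono (integrable_of_continuous (hTc k).norm) (integrable_const _) fun ζ => ?_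
        simp only [hT, norm_mul, norm_pow, RCLike.norm_natCast]
        have e1 := hqn ζ
        have e2 := hC ζ (Set.mem_univ _)
        gcongr
      simpa using this)
  have hI : ∀ k, ∫ ζ, T k ζ ∂(sigma (n + 1)) = b k * ((r : ℂ) ^ 2 * s) ^ k := by
    intro k
    have e1 : ∀ ζ, T k ζ = ((k + n).choose n : ℂ) * (s * r) ^ k *
        (F ((r : ℂ) • (ζ : CN (n + 1))) * (starRingEnd ℂ) ((ζ : CN (n + 1)) 0) ^ k) := by
      intro ζ
      simp only [hT, hq, map_mul, Complex.conj_ofReal]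
      ring
    simp only [e1]
    rw [integral_const_mul, integral_mul_conj_pow hF hb h0 h1]
    linear_combination ((s : ℂ) * r) ^ k * b k * (r : ℂ) ^ k * choose_mul_moment n k
  simp only [hI] at hsum
  have hlt : ‖((r : ℂ) ^ 2 * s)‖ < 1 := by
    rw [norm_mul, norm_pow, Complex.norm_real, Complex.norm_real, Real.norm_of_nonneg h0,
      Real.norm_of_nonneg hs0]
    nlinarith
  rw [(hb _ hlt).unique hsum]
  refine integral_congr_ae (Eventually.of_forall fun ζ => ?_)
  exact ((hker ζ).mul_right _).tsum_eq.symm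

/-- The Cauchy formula on the sphere of radius `r`. -/
lemma integral_szego {N : ℕ} [NeZero N] {F : CN N → ℂ} (hF : DifferentiableOn ℂ F (ball N))
    {w : CN N} (hw : w ∈ ball N) {r : ℝ} (h0 : 0 ≤ r) (h1 : r < 1) :
    ∫ ζ : sphere N, (starRingEnd ℂ) (szego w ((r : ℂ) • (ζ : CN N))) *
      F ((r : ℂ) • (ζ : CN N)) ∂(sigma N) = F ((r : ℂ) ^ 2 • w) := by
  -- Both `σ` and the kernel are invariant under unitaries, so `w` may be rotated onto the first
  -- axis.
  obtain ⟨L, hL⟩ : ∃ L : CN N ≃ₗᵢ[ℂ] CN N,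
      L ((‖w‖ : ℂ) • EuclideanSpace.single (0 : Fin N) (1 : ℂ)) = w := by
    by_cases hw0 : w = 0
    · exact ⟨LinearIsometryEquiv.refl ℂ _, by simp [hw0]⟩
    · have hn : (‖w‖ : ℂ) ≠ 0 := by simpa using hw0
      obtain ⟨L, hL⟩ := exists_unitary_apply_single (v := (‖w‖ : ℂ)⁻¹ • w) (by
        rw [norm_smul, norm_inv, Complex.norm_real, norm_norm]
        exact inv_mul_cancel₀ (by simpa using hw0))
      exact ⟨L, by rw [map_smul, hL, smul_smul, mul_inv_cancel₀ hn, one_smul]⟩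
  have hFL : DifferentiableOn ℂ (fun z => F (L z)) (ball N) := by
    refine hF.comp L.toContinuousLinearEquiv.differentiable.differentiableOn fun z hz => ?_
    rw [mem_ball_zero_iff] at hz ⊢
    have : ‖L z‖ = ‖z‖ := L.norm_map z
    exact this.trans_lt hz
  have key := integral_szego_axis hFL (norm_nonneg w) (mem_ball_zero_iff.mp hw) h0 h1
  rw [← smul_smul, map_smul, hL] at key
  rw [← key, ← integral_comp_unitary L (fun z : CN N =>
    (starRingEnd ℂ) (szego w ((r : ℂ) • z)) * F ((r : ℂ) • z))]
  refine integral_congr_ae (Eventually.of_forall fun ζ => ?_)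
  have e2 : szego w (L ((r : ℂ) • (ζ : CN N))) =
      szego ((‖w‖ : ℂ) • EuclideanSpace.single (0 : Fin N) (1 : ℂ)) ((r : ℂ) • (ζ : CN N)) := by
    unfold szego
    rw [← hL, L.inner_map_map, hL]
  simp only [← map_smul, e2]

/-! ### Reproducing kernels of the Hardy space -/

lemma ext_of_mem {N : ℕ} (f : ball N → ℂ) {z : CN N} (hz : z ∈ ball N) : ext f z = f ⟨z, hz⟩ :=
  ext_coe f ⟨z, hz⟩

lemma ext_sub {N : ℕ} (f g : ball N → ℂ) : ext (f - g) = ext f - ext g := by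
  have : f - g = f + (-1 : ℂ) • g := by
    rw [neg_one_smul, sub_eq_add_neg]
  rw [this, ext_add, ext_smul, neg_one_smul, sub_eq_add_neg]

lemma holo_restrict {N : ℕ} {F : CN N → ℂ} (hF : DifferentiableOn ℂ F (ball N)) :
    Holo fun z : ball N => F z :=
  hF.congr fun _ hz => ext_of_mem _ hz

lemma norm_inner_lt_one {N : ℕ} {w z : CN N} (hw : w ∈ ball N) (hz : z ∈ ball N) :
    ‖inner ℂ w z‖ < 1 := by
  rw [mem_ball_zero_iff] at hw hz
  have := norm_inner_le_norm (𝕜 := ℂ) w z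
  nlinarith [norm_nonneg w, norm_nonneg z]

lemma one_sub_inner_ne_zero {N : ℕ} {w z : CN N} (hw : w ∈ ball N) (hz : z ∈ ball N) :
    1 - inner ℂ w z ≠ 0 := by
  intro h
  have := norm_inner_lt_one hw hz
  rw [← sub_eq_zero.mp h] at this
  simp at this

lemma differentiable_inner_right {N : ℕ} (w : CN N) :
    Differentiable ℂ fun z : CN N => inner ℂ w z :=
  (innerSL ℂ w).differentiable

lemma differentiableOn_szego {N : ℕ} {w : CN N} (hw : w ∈ ball N) :
    DifferentiableOn ℂ (szego w) (ball N) := by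
  intro z hz
  exact (((differentiable_inner_right w z).const_sub 1).pow N).inv
    (pow_ne_zero _ (one_sub_inner_ne_zero hw hz)) |>.differentiableWithinAt

lemma norm_szego_le {N : ℕ} {w z : CN N} {c : ℝ} (hc : c < 1) (h : ‖inner ℂ w z‖ ≤ c) :
    ‖szego w z‖ ≤ ((1 - c) ^ N)⁻¹ := by
  rw [szego, norm_inv, norm_pow]
  have h1 : 1 - c ≤ ‖1 - inner ℂ w z‖ := by
    have := norm_sub_norm_le (1 : ℂ) (inner ℂ w z)
    rw [norm_one] at this
    linarith
  have h2 : 0 < 1 - c := by linarith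
  gcongr

lemma mem_hardy_of_bounded {N : ℕ} [NeZero N] {f : ball N → ℂ} (hf : Holo f) {C : ℝ}
    (hC : ∀ z, ‖f z‖ ≤ C) : f ∈ hardySubmodule N := by
  refine ⟨hf, C ^ 2, ?_⟩
  rintro _ ⟨r, hr, rfl⟩
  have hn := norm_ofReal_lt hr.1.le hr.2
  have hc := continuous_slice hf hn
  have : mean f r ≤ ∫ _ζ : sphere N, C ^ 2 ∂(sigma N) := by
    refine integral_mono (integrable_of_continuous (by fun_prop)) (integrable_const _) fun ζ => ?_
    simp only
    rw [ext_of_mem _ (smul_mem_ball hn ζ)]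
    have := hC ⟨_, smul_mem_ball hn ζ⟩
    gcongr
  simpa using this

lemma szego_mem_hardy {N : ℕ} [NeZero N] {w : CN N} (hw : w ∈ ball N) :
    (fun z : ball N => szego w (z : CN N)) ∈ hardySubmodule N := by
  refine mem_hardy_of_bounded (holo_restrict (differentiableOn_szego hw))
    (C := ((1 - ‖w‖) ^ N)⁻¹) fun z => norm_szego_le (mem_ball_zero_iff.mp hw) ?_
  have h1 := norm_inner_le_norm (𝕜 := ℂ) w (z : CN N)
  have h2 := mem_ball_zero_iff.mp z.2
  have h3 := norm_nonneg w
  nlinarith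

/-- An element of `H²` from a function on the ball. -/
def mkH2 {N : ℕ} (f : ball N → ℂ) (hf : f ∈ hardySubmodule N) : H2 N :=
  (⟨f, hf⟩ : hardySubmodule N)

/-- The reproducing kernel of `H²` at `w`. -/
def kerFun {N : ℕ} [NeZero N] (w : ball N) : H2 N := mkH2 _ (szego_mem_hardy w.2)

lemma kerFun_apply {N : ℕ} [NeZero N] (w z : ball N) :
    (kerFun w : ball N → ℂ) z = szego (w : CN N) z := rfl

/-- The reproducing property. -/
lemma inner_kerFun {N : ℕ} [NeZero N] (w : ball N) (f : H2 N) :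
    inner ℂ (kerFun w) f = (f : ball N → ℂ) w := by
  have h1 := tendsto_pair (kerFun w) f
  have hf : DifferentiableOn ℂ (ext (f : ball N → ℂ)) (ball N) := f.2.1
  -- By the Cauchy formula the pairing at radius `r` equals `f(r² w)`, which tends to `f(w)` by
  -- continuity.
  have h2 : Tendsto (fun r : ℝ => ext (f : ball N → ℂ) ((r : ℂ) ^ 2 • (w : CN N))) (𝓝[<] 1)
      (𝓝 ((f : ball N → ℂ) w)) := by
    have hc : ContinuousAt (ext (f : ball N → ℂ)) (w : CN N) :=
      hf.continuousOn.continuousAt (Metric.isOpen_ball.mem_nhds w.2)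
    have hg : Tendsto (fun r : ℝ => (r : ℂ) ^ 2 • (w : CN N)) (𝓝[<] 1) (𝓝 (w : CN N)) := by
      have : Continuous fun r : ℝ => (r : ℂ) ^ 2 • (w : CN N) := by fun_prop
      have := this.tendsto 1
      simp only [Complex.ofReal_one, one_pow, one_smul] at this
      exact this.mono_left nhdsWithin_le_nhds
    have := hc.tendsto.comp hg
    rwa [ext_coe] at this
  refine tendsto_nhds_unique h1 (h2.congr' ?_)
  filter_upwards [eventually_Ioo] with r hr
  rw [← integral_szego hf w.2 hr.1.le hr.2, pair]
  refine integral_congr_ae (Eventually.of_forall fun ζ => ?_)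
  simp only
  rw [ext_of_mem (kerFun w : ball N → ℂ) (smul_mem_ball (norm_ofReal_lt hr.1.le hr.2) ζ),
    kerFun_apply]

lemma H2_ext {N : ℕ} {f g : H2 N} (h : ∀ z, (f : ball N → ℂ) z = (g : ball N → ℂ) z) : f = g :=
  Subtype.ext (funext h)

lemma inner_kerFun_kerFun {N : ℕ} [NeZero N] (w z : ball N) :
    inner ℂ (kerFun z) (kerFun w) = szego (w : CN N) z := by
  rw [inner_kerFun, kerFun_apply]

/-- Point evaluations are locally uniformly bounded. -/
lemma norm_apply_le {N : ℕ} [NeZero N] {ρ : ℝ} (hρ : ρ < 1) {z : ball N} (hz : ‖(z : CN N)‖ ≤ ρ)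
    (f : H2 N) : ‖(f : ball N → ℂ) z‖ ≤ √(((1 - ρ ^ 2) ^ N)⁻¹) * ‖f‖ := by
  rw [← inner_kerFun]
  refine (norm_inner_le_norm _ _).trans (mul_le_mul_of_nonneg_right ?_ (norm_nonneg f))
  apply Real.le_sqrt_of_sq_le
  have h1 := inner_self_eq_norm_sq_to_K (𝕜 := ℂ) (kerFun z)
  rw [inner_kerFun_kerFun] at h1
  have h2 : ‖kerFun z‖ ^ 2 = ‖szego (z : CN N) z‖ := by
    rw [h1, norm_pow]
    simp
  rw [h2]
  have h0 := norm_nonneg (z : CN N)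
  refine norm_szego_le (by nlinarith) ((norm_inner_le_norm _ _).trans ?_)
  nlinarith

lemma mean_le_norm_sq {N : ℕ} [NeZero N] (f : H2 N) {r : ℝ} (hr : r ∈ Set.Ioo (0 : ℝ) 1) :
    mean (f : ball N → ℂ) r ≤ ‖f‖ ^ 2 := by
  rw [norm_sq_H2]
  exact le_csSup f.2.2 ⟨r, hr, rfl⟩

/-! ### Completeness -/

/-- A uniform limit of holomorphic functions on a ball is holomorphic at the centre. -/
lemma differentiableAt_of_tendstoUniformlyOn {E : Type*} [NormedAddCommGroup E] [NormedSpace ℂ E]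
    {F : ℕ → E → ℂ} {f : E → ℂ} {z₀ : E} {δ : ℝ} (hδ : 0 < δ)
    (hF : ∀ n, DifferentiableOn ℂ (F n) (Metric.ball z₀ (2 * δ)))
    (h : TendstoUniformlyOn F f atTop (Metric.ball z₀ (2 * δ))) : DifferentiableAt ℂ f z₀ := by
  have hsub : ∀ z ∈ Metric.ball z₀ δ, Metric.ball z δ ⊆ Metric.ball z₀ (2 * δ) := by
    intro z hz w hw
    rw [Metric.mem_ball] at hz hw ⊢
    linarith [dist_triangle w z z₀]
  have hsub' : Metric.ball z₀ δ ⊆ Metric.ball z₀ (2 * δ) :=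
    Metric.ball_subset_ball (by linarith)
  have hd : ∀ n, ∀ z ∈ Metric.ball z₀ δ, HasFDerivAt (F n) (fderiv ℂ (F n) z) z := fun n z hz =>
    ((hF n).differentiableAt (Metric.isOpen_ball.mem_nhds (hsub' hz))).hasFDerivAt
  have hC : UniformCauchySeqOn (fun n z => fderiv ℂ (F n) z) atTop (Metric.ball z₀ δ) := by
    rw [Metric.uniformCauchySeqOn_iff]
    intro ε hε
    -- With differences below `ε δ / 4`, their oscillation about the centre is at most `ε δ / 2`,
    -- and the Cauchy estimate on a ball of radius `δ` bounds the derivative by `ε / 2`. The radius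
    -- `2 * δ` in the hypotheses leaves room for these balls.
    obtain ⟨M, hM⟩ := Metric.uniformCauchySeqOn_iff.mp h.uniformCauchySeqOn (ε * δ / 4)
      (by positivity)
    refine ⟨M, fun m hm n hn z hz => ?_⟩
    have hb : ∀ w ∈ Metric.ball z δ, ‖F m w - F n w‖ ≤ ε * δ / 4 := fun w hw => by
      rw [← dist_eq_norm]
      exact (hM m hm n hn w (hsub z hz hw)).le
    have h1 := Complex.norm_fderiv_le_div_of_mapsTo_ball (f := fun w => F m w - F n w)
      (R₂ := ε * δ / 2) (((hF m).sub (hF n)).mono (hsub z hz)) (fun w hw => by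
        rw [mem_closedBall_iff_norm]
        have := norm_sub_le (F m w - F n w) (F m z - F n z)
        linarith [hb w hw, hb z (Metric.mem_ball_self hδ)]) hδ
    rw [fderiv_fun_sub (hd m z hz).differentiableAt (hd n z hz).differentiableAt] at h1
    rw [dist_eq_norm]
    refine h1.trans_lt ?_
    rw [mul_div_assoc, mul_div_assoc, div_right_comm, div_self hδ.ne']
    linarith
  have hlim : ∀ z : E, ∃ g : E →L[ℂ] ℂ, z ∈ Metric.ball z₀ δ →
      Tendsto (fun n => fderiv ℂ (F n) z) atTop (𝓝 g) := by
    intro z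
    by_cases hz : z ∈ Metric.ball z₀ δ
    · obtain ⟨g, hg⟩ := cauchySeq_tendsto_of_complete (hC.cauchySeq hz)
      exact ⟨g, fun _ => hg⟩
    · exact ⟨0, fun h => absurd h hz⟩
  choose g hg using hlim
  exact (hasFDerivAt_of_tendstoUniformlyOn Metric.isOpen_ball
    (hC.tendstoUniformlyOn_of_tendsto hg) hd
    (fun z hz => h.tendsto_at (hsub' hz)) (Metric.mem_ball_self hδ)).differentiableAt

/-- The local bound on point evaluations turns a Cauchy sequence in norm into one that is uniformly
Cauchy on smaller balls. -/
lemma holo_of_tendsto {N : ℕ} [NeZero N] {u : ℕ → H2 N} (hu : CauchySeq u) {f : ball N → ℂ}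
    (hf : ∀ z, Tendsto (fun n => (u n : ball N → ℂ) z) atTop (𝓝 (f z))) : Holo f := by
  intro z₀ hz₀
  rw [mem_ball_zero_iff] at hz₀
  set ρ : ℝ := (1 + ‖z₀‖) / 2 with hρ
  have hρ1 : ρ < 1 := by rw [hρ]; linarith
  set δ : ℝ := (1 - ‖z₀‖) / 4 with hδ
  have hδ0 : 0 < δ := by rw [hδ]; linarith
  have hnorm : ∀ z ∈ Metric.ball z₀ (2 * δ), ‖z‖ ≤ ρ := by
    intro z hz
    rw [mem_ball_iff_norm] at hz
    have := norm_add_le (z - z₀) z₀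
    rw [sub_add_cancel] at this
    rw [hδ] at hz
    rw [hρ]
    linarith
  have hmem : ∀ z ∈ Metric.ball z₀ (2 * δ), z ∈ ball N := fun z hz =>
    mem_ball_zero_iff.mpr ((hnorm z hz).trans_lt hρ1)
  refine (differentiableAt_of_tendstoUniformlyOn (F := fun n => ext (u n : ball N → ℂ)) hδ0
    (fun n => DifferentiableOn.mono (u n).2.1 hmem) ?_).differentiableWithinAt
  refine UniformCauchySeqOn.tendstoUniformlyOn_of_tendsto ?_ fun z hz => ?_
  · rw [Metric.uniformCauchySeqOn_iff]
    intro ε hε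
    set K : ℝ := √(((1 - ρ ^ 2) ^ N)⁻¹) with hK
    have hK0 : 0 ≤ K := Real.sqrt_nonneg _
    obtain ⟨M, hM⟩ := Metric.cauchySeq_iff.mp hu (ε / (K + 1)) (by positivity)
    refine ⟨M, fun m hm n hn z hz => ?_⟩
    rw [dist_eq_norm, ← Pi.sub_apply, ← ext_sub, ext_of_mem _ (hmem z hz)]
    have h1 := norm_apply_le hρ1 (z := ⟨z, hmem z hz⟩) (hnorm z hz) (u m - u n)
    have h2 := hM m hm n hn
    rw [dist_eq_norm] at h2
    calc _ ≤ K * ‖u m - u n‖ := h1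
      _ ≤ K * (ε / (K + 1)) := by gcongr
      _ < (K + 1) * (ε / (K + 1)) := by
        have : 0 < ε / (K + 1) := by positivity
        nlinarith
      _ = ε := by field_simp
  · rw [ext_of_mem _ (hmem z hz)]
    simp only [ext_of_mem _ (hmem z hz)]
    exact hf _

instance instCompleteSpaceH2 (N : ℕ) [NeZero N] : CompleteSpace (H2 N) := by
  refine Metric.complete_of_cauchySeq_tendsto fun u hu => ?_
  have hpt : ∀ z : ball N, ∃ c : ℂ, Tendsto (fun n => (u n : ball N → ℂ) z) atTop (𝓝 c) := by
    intro z
    obtain ⟨c, hc⟩ := cauchySeq_tendsto_of_complete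
      ((innerSL ℂ (kerFun z)).uniformContinuous.comp_cauchySeq hu)
    exact ⟨c, hc.congr fun n => inner_kerFun z (u n)⟩
  choose f hf using hpt
  have hfh : Holo f := holo_of_tendsto hu hf
  -- The index `M` is independent of `r`: for each `r` dominated convergence lets `m → ∞` in a bound
  -- by the norm of `u n - u m`. The supremum over `r` can then be taken.
  have key : ∀ ε : ℝ, 0 < ε → ∃ M, ∀ n ≥ M, ∀ r ∈ Set.Ioo (0 : ℝ) 1,
      mean ((u n : ball N → ℂ) - f) r ≤ ε ^ 2 := by
    intro ε hε
    obtain ⟨M, hM⟩ := Metric.cauchySeq_iff.mp hu ε hε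
    refine ⟨M, fun n hn r hr => ?_⟩
    have hrn := norm_ofReal_lt hr.1.le hr.2
    have hle : ∀ m ≥ M, ‖u n - u m‖ ≤ ε := fun m hm => by
      rw [← dist_eq_norm]
      exact (hM n hn m hm).le
    have hT : Tendsto (fun m => mean ((u n : ball N → ℂ) - (u m : ball N → ℂ)) r) atTop
        (𝓝 (mean ((u n : ball N → ℂ) - f) r)) := by
      refine tendsto_integral_filter_of_dominated_convergence
        (fun _ => (√(((1 - r ^ 2) ^ N)⁻¹) * ε) ^ 2) ?_ ?_ (integrable_const _) ?_
      · refine Eventually.of_forall fun m => ?_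
        have := continuous_slice (u n - u m).2.1 hrn
        exact (this.norm.pow 2).aestronglyMeasurable
      · filter_upwards [eventually_ge_atTop M] with m hm
        refine Eventually.of_forall fun ζ => ?_
        have hmem := smul_mem_ball hrn ζ
        rw [ext_of_mem _ hmem, norm_pow, norm_norm]
        have hz : ‖(r : ℂ) • (ζ : CN N)‖ ≤ r := by
          have h3 := ζ.2
          rw [mem_sphere_zero_iff_norm] at h3
          rw [norm_smul, h3, Complex.norm_real, Real.norm_of_nonneg hr.1.le, mul_one]
        have h1 := norm_apply_le hr.2 (z := ⟨_, hmem⟩) hz (u n - u m)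
        refine pow_le_pow_left₀ (norm_nonneg _) (h1.trans ?_) 2
        exact mul_le_mul_of_nonneg_left (hle m hm) (Real.sqrt_nonneg _)
      · refine Eventually.of_forall fun ζ => ?_
        simp only [ext_of_mem _ (smul_mem_ball hrn ζ), Pi.sub_apply]
        exact (((hf _).const_sub _).norm).pow 2
    refine le_of_tendsto hT ?_
    filter_upwards [eventually_ge_atTop M] with m hm
    refine (mean_le_norm_sq (u n - u m) hr).trans ?_
    exact pow_le_pow_left₀ (norm_nonneg _) (hle m hm) 2
  have hfH : f ∈ hardySubmodule N := by
    obtain ⟨M, hM⟩ := key 1 one_pos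
    have h1 : (u M : ball N → ℂ) - f ∈ hardySubmodule N := by
      refine ⟨?_, 1 ^ 2, ?_⟩
      · unfold Holo
        rw [ext_sub]
        exact DifferentiableOn.sub (u M).2.1 hfh
      · rintro _ ⟨r, hr, rfl⟩
        exact hM M le_rfl r hr
    have h2 := (hardySubmodule N).sub_mem (u M).2 h1
    rwa [sub_sub_cancel] at h2
  refine ⟨mkH2 f hfH, ?_⟩
  rw [Metric.tendsto_atTop]
  intro ε hε
  obtain ⟨M, hM⟩ := key (ε / 2) (by positivity)
  refine ⟨M, fun n hn => ?_⟩
  rw [dist_eq_norm]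
  have h1 : ‖u n - mkH2 f hfH‖ ^ 2 ≤ (ε / 2) ^ 2 := by
    rw [norm_sq_H2]
    refine csSup_le ((Set.nonempty_Ioo.mpr zero_lt_one).image _) ?_
    rintro _ ⟨r, hr, rfl⟩
    exact hM n hn r hr
  have h2 := (sq_le_sq₀ (norm_nonneg _) (by positivity)).mp h1
  linarith

/-- Linear combinations of reproducing kernels are dense. -/
lemma denseRange_linearCombination {N : ℕ} [NeZero N] {ι : Type*} {k : ι → H2 N}
    (h : ∀ f : H2 N, (∀ i, inner ℂ (k i) f = 0) → f = 0) :
    DenseRange (Finsupp.linearCombination ℂ k) := by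
  have h1 : (Submodule.span ℂ (Set.range k)).topologicalClosure = ⊤ := by
    -- By completeness, a subspace is dense as soon as its orthogonal complement is zero.
    rw [Submodule.topologicalClosure_eq_top_iff, Submodule.eq_bot_iff]
    intro f hf
    refine h f fun i => ?_
    exact Submodule.inner_right_of_mem_orthogonal
      (Submodule.subset_span (Set.mem_range_self i)) hf
  rw [DenseRange, ← LinearMap.coe_range, Finsupp.range_linearCombination]
  exact Submodule.dense_iff_topologicalClosure_eq_top.mpr h1

/-! ### Unitarity and the kernel identity -/

/-- A unitary weighted composition operator transforms the Cauchy–Szegő kernel into itself. -/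
lemma szego_identity_of_isUnitary {N : ℕ} [NeZero N] {ψ : ball N → ℂ} {φ : ball N → ball N}
    (h : IsUnitaryOnH2 ψ φ) (w z : ball N) :
    ψ z * (starRingEnd ℂ) (ψ w) * szego (φ w : CN N) (φ z) = szego (w : CN N) z := by
  obtain ⟨U, hU⟩ := h
  -- The inverse of a unitary is its adjoint, and the reproducing property gives the adjoint on
  -- kernels.
  have hinv : ∀ v : ball N, U.symm (kerFun v) = (starRingEnd ℂ) (ψ v) • kerFun (φ v) := by
    intro v
    refine ext_inner_right ℂ fun f => ?_
    rw [← U.inner_map_map, U.apply_symm_apply, inner_kerFun, hU, inner_smul_left, inner_kerFun,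
      Complex.conj_conj]
    rfl
  have h1 := inner_kerFun_kerFun w z
  rw [← U.symm.inner_map_map, hinv, hinv, inner_smul_left, inner_smul_right, inner_kerFun_kerFun,
    Complex.conj_conj, ← mul_assoc] at h1
  exact h1

/-- Families of vectors with the same Gram matrix have linear combinations of the same norm. -/
lemma norm_linearCombination_eq_of_inner {E F ι : Type*} [NormedAddCommGroup E]
    [InnerProductSpace ℂ E] [NormedAddCommGroup F] [InnerProductSpace ℂ F] {u : ι → E} {v : ι → F}
    (h : ∀ i j, (inner ℂ (u i) (u j) : ℂ) = inner ℂ (v i) (v j)) (x : ι →₀ ℂ) :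
    ‖Finsupp.linearCombination ℂ u x‖ = ‖Finsupp.linearCombination ℂ v x‖ := by
  have h1 : (inner ℂ (Finsupp.linearCombination ℂ u x) (Finsupp.linearCombination ℂ u x) : ℂ) =
      inner ℂ (Finsupp.linearCombination ℂ v x) (Finsupp.linearCombination ℂ v x) := by
    simp only [Finsupp.linearCombination_apply, Finsupp.sum, sum_inner, inner_sum,
      inner_smul_left, inner_smul_right, h]
  rw [inner_self_eq_norm_sq_to_K, inner_self_eq_norm_sq_to_K] at h1
  have h2 : ‖Finsupp.linearCombination ℂ u x‖ ^ 2 = ‖Finsupp.linearCombination ℂ v x‖ ^ 2 := by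
    exact_mod_cast h1
  exact (pow_left_inj₀ (norm_nonneg _) (norm_nonneg _) two_ne_zero).mp h2

/-- If the Cauchy–Szegő kernel is transformed into itself and `φ` is onto, the weighted composition
operator is unitary. -/
lemma isUnitary_of_szego_identity {N : ℕ} [NeZero N] {ψ : ball N → ℂ} {φ : ball N → ball N}
    (hφ : Function.Surjective φ) (hψ : ∀ z, ψ z ≠ 0)
    (h : ∀ w z, ψ z * (starRingEnd ℂ) (ψ w) * szego (φ w : CN N) (φ z) = szego (w : CN N) z) :
    IsUnitaryOnH2 ψ φ := by
  set k : ball N → H2 N := fun w => (starRingEnd ℂ) (ψ w) • kerFun (φ w) with hk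
  have hkf : ∀ w (f : H2 N), inner ℂ (k w) f = ψ w * (f : ball N → ℂ) (φ w) := by
    intro w f
    rw [hk, inner_smul_left, inner_kerFun, Complex.conj_conj]
  -- Orthogonality to every `k w` says `ψ(w) f(φ(w)) = 0`; here both the surjectivity of `φ` and `ψ
  -- ≠ 0` are needed.
  have hd1 : DenseRange (Finsupp.linearCombination ℂ k) := by
    refine denseRange_linearCombination fun f hf => H2_ext fun z => ?_
    obtain ⟨w, rfl⟩ := hφ z
    have := hf w
    rw [hkf] at this
    exact (mul_eq_zero.mp this).resolve_left (hψ w)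
  have hd2 : DenseRange (Finsupp.linearCombination ℂ (kerFun (N := N))) := by
    refine denseRange_linearCombination fun f hf => H2_ext fun z => ?_
    have := hf z
    rwa [inner_kerFun] at this
  have hgram : ∀ z w, (inner ℂ (kerFun z) (kerFun w) : ℂ) = inner ℂ (k z) (k w) := by
    intro z w
    rw [inner_kerFun_kerFun, hkf, ← h w z, hk]
    change _ = ψ z * ((starRingEnd ℂ) (ψ w) * szego (φ w : CN N) (φ z))
    rw [mul_assoc]
  -- `U` extends `k w ↦ K_w`, the inverse of the expected adjoint. Its action on functions follows
  -- from `(U f)(w) = ⟪K_w, U f⟫ = ⟪U (k w), U f⟫ = ⟪k w, f⟫` in the order of `inner`.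
  set U : H2 N ≃ₗᵢ[ℂ] H2 N := (LinearEquiv.refl ℂ (ball N →₀ ℂ)).extendOfIsometry
    (Finsupp.linearCombination ℂ k) (Finsupp.linearCombination ℂ (kerFun (N := N))) hd1 hd2
    (fun x => norm_linearCombination_eq_of_inner hgram x) with hUdef
  have hUk : ∀ w, U (k w) = kerFun w := by
    intro w
    have := LinearEquiv.extendOfIsometry_eq (LinearEquiv.refl ℂ (ball N →₀ ℂ))
      (Finsupp.linearCombination ℂ k) (Finsupp.linearCombination ℂ (kerFun (N := N))) hd1 hd2
      (fun x => norm_linearCombination_eq_of_inner hgram x) (Finsupp.single w 1)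
    simpa using this
  refine ⟨U, fun f => funext fun w => ?_⟩
  rw [← inner_kerFun, ← hUk, U.inner_map_map, hkf]
  rfl

/-! ### The linear fractional symbol -/

lemma conjVec_apply {N : ℕ} (a : CN N) (i : Fin N) : conjVec a i = (starRingEnd ℂ) (a i) := rfl

lemma conjVec_conjVec {N : ℕ} (a : CN N) : conjVec (conjVec a) = a := by
  ext i
  simp [conjVec_apply]

lemma norm_conjVec {N : ℕ} (a : CN N) : ‖conjVec a‖ = ‖a‖ := by
  simp [EuclideanSpace.norm_eq, conjVec_apply]

lemma map_conj_map_conj {N : ℕ} (A : Matrix (Fin N) (Fin N) ℂ) :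
    (A.map (starRingEnd ℂ)).map (starRingEnd ℂ) = A := by
  ext i j
  simp

lemma conjVec_toEuclideanLin {N : ℕ} (A : Matrix (Fin N) (Fin N) ℂ) (z : CN N) :
    conjVec (Matrix.toEuclideanLin A z) =
      Matrix.toEuclideanLin (A.map (starRingEnd ℂ)) (conjVec z) := by
  ext i
  simp [conjVec_apply, Matrix.toLpLin_apply, Matrix.mulVec, dotProduct]

lemma inner_toEuclideanLin {N : ℕ} {A : Matrix (Fin N) (Fin N) ℂ} (hA : A.IsSymm) (x z : CN N) :
    inner ℂ x (Matrix.toEuclideanLin A z) =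
      inner ℂ (Matrix.toEuclideanLin (A.map (starRingEnd ℂ)) x) z := by
  have h : A.map (starRingEnd ℂ) = A.conjTranspose := by
    rw [Matrix.conjTranspose, hA.eq]
    rfl
  rw [h, Matrix.toEuclideanLin_conjTranspose_eq_adjoint, LinearMap.adjoint_inner_left]

/-- The relations on `a₀` and `A` that make `φ` an automorphism of the ball. -/
structure AutRel {N : ℕ} (a₀ : CN N) (A : Matrix (Fin N) (Fin N) ℂ) : Prop where
  symm : A.IsSymm
  mul : A.map (starRingEnd ℂ) * A - Matrix.vecMulVec (conjVec a₀) a₀ =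
    ((1 - ‖a₀‖ ^ 2 : ℝ) : ℂ) • (1 : Matrix (Fin N) (Fin N) ℂ)
  fix : Matrix.toEuclideanLin A (conjVec a₀) = a₀

namespace AutRel

variable {N : ℕ} {a₀ : CN N} {A : Matrix (Fin N) (Fin N) ℂ}

/-- The conjugate data define the inverse automorphism, so every consequence of the relations also
applies to it. -/
lemma conj (h : AutRel a₀ A) : AutRel (conjVec a₀) (A.map (starRingEnd ℂ)) where
  symm := h.symm.map _
  mul := by
    have h1 := congrArg (fun M : Matrix (Fin N) (Fin N) ℂ => M.map (starRingEnd ℂ)) h.mul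
    rw [norm_conjVec]
    ext i j
    have h2 := congrFun (congrFun h1 i) j
    simp only [Matrix.map_apply, Matrix.sub_apply, Matrix.mul_apply, Matrix.vecMulVec_apply,
      Matrix.smul_apply, map_sub, map_sum, map_mul, smul_eq_mul, Complex.conj_ofReal,
      Matrix.one_apply, conjVec_apply, Complex.conj_conj, apply_ite (starRingEnd ℂ), map_one,
      map_zero] at h2 ⊢
    exact h2
  fix := by rw [← conjVec_toEuclideanLin, h.fix]

lemma inner_left (h : AutRel a₀ A) (z : CN N) :
    inner ℂ a₀ (Matrix.toEuclideanLin A z) = inner ℂ (conjVec a₀) z := by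
  have := h.conj.fix
  rw [conjVec_conjVec] at this
  rw [inner_toEuclideanLin h.symm, this]

lemma map_map (h : AutRel a₀ A) (z : CN N) :
    Matrix.toEuclideanLin (A.map (starRingEnd ℂ)) (Matrix.toEuclideanLin A z) =
      ((1 - ‖a₀‖ ^ 2 : ℝ) : ℂ) • z + (inner ℂ (conjVec a₀) z : ℂ) • conjVec a₀ := by
  have h1 : A.map (starRingEnd ℂ) * A = ((1 - ‖a₀‖ ^ 2 : ℝ) : ℂ) • (1 : Matrix (Fin N) (Fin N) ℂ) +
      Matrix.vecMulVec (conjVec a₀) a₀ := sub_eq_iff_eq_add.mp h.mul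
  have h2 := congrArg (fun M => M.mulVec z.ofLp) h1
  simp only [← Matrix.mulVec_mulVec, Matrix.add_mulVec, Matrix.smul_mulVec, Matrix.one_mulVec] at h2
  ext i
  have h3 := congrFun h2 i
  simp only [Matrix.toLpLin_apply, PiLp.add_apply, PiLp.smul_apply, smul_eq_mul] at h3 ⊢
  rw [h3]
  simp [Matrix.mulVec, dotProduct, Matrix.vecMulVec_apply, PiLp.inner_apply, conjVec_apply,
    Finset.sum_mul]
  refine Finset.sum_congr rfl fun j _ => ?_
  ring

lemma inner_map_map (h : AutRel a₀ A) (w z : CN N) :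
    inner ℂ (Matrix.toEuclideanLin A w) (Matrix.toEuclideanLin A z) =
      ((1 - ‖a₀‖ ^ 2 : ℝ) : ℂ) * inner ℂ w z +
        inner ℂ (conjVec a₀) z * (starRingEnd ℂ) (inner ℂ (conjVec a₀) w) := by
  have h1 : inner ℂ (Matrix.toEuclideanLin A w) (Matrix.toEuclideanLin A z) =
      inner ℂ w (Matrix.toEuclideanLin (A.map (starRingEnd ℂ)) (Matrix.toEuclideanLin A z)) := by
    rw [inner_toEuclideanLin (h.symm.map _), map_conj_map_conj]
  rw [h1, h.map_map, inner_add_right, inner_smul_right, inner_smul_right, inner_conj_symm]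

end AutRel

/-- The numerator of `1 - ⟨φ(z), φ(w)⟩`. -/
def autNum {N : ℕ} (a₀ : CN N) (A : Matrix (Fin N) (Fin N) ℂ) (w z : CN N) : ℂ :=
  (1 - inner ℂ (conjVec a₀) z) * (starRingEnd ℂ) (1 - inner ℂ (conjVec a₀) w) -
    inner ℂ (a₀ - Matrix.toEuclideanLin A w) (a₀ - Matrix.toEuclideanLin A z)

/-- Sorted by degree: constant, linear in `z`, conjugate-linear in `w`, sesquilinear. The relation
`fix` kills the middle terms and the relation `mul` governs the last. -/
lemma autNum_eq_add {N : ℕ} (a₀ : CN N) (A : Matrix (Fin N) (Fin N) ℂ) (w z : CN N) :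
    autNum a₀ A w z = ((1 - ‖a₀‖ ^ 2 : ℝ) : ℂ) +
      (inner ℂ a₀ (Matrix.toEuclideanLin A z) - inner ℂ (conjVec a₀) z) +
      (starRingEnd ℂ) (inner ℂ a₀ (Matrix.toEuclideanLin A w) - inner ℂ (conjVec a₀) w) +
      (inner ℂ (conjVec a₀) z * (starRingEnd ℂ) (inner ℂ (conjVec a₀) w) -
        inner ℂ (Matrix.toEuclideanLin A w) (Matrix.toEuclideanLin A z)) := by
  have h : (inner ℂ a₀ a₀ : ℂ) = ((‖a₀‖ ^ 2 : ℝ) : ℂ) := by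
    rw [inner_self_eq_norm_sq_to_K]
    simp
  rw [autNum, inner_sub_left, inner_sub_right, inner_sub_right, h, map_sub, map_sub, map_one,
    inner_conj_symm _ a₀]
  push_cast
  ring

lemma AutRel.autNum_eq {N : ℕ} {a₀ : CN N} {A : Matrix (Fin N) (Fin N) ℂ} (h : AutRel a₀ A)
    (w z : CN N) : autNum a₀ A w z = ((1 - ‖a₀‖ ^ 2 : ℝ) : ℂ) * (1 - inner ℂ w z) := by
  rw [autNum_eq_add, h.inner_left, h.inner_left, h.inner_map_map]
  simp
  ring

lemma one_sub_inner_conjVec_ne_zero {N : ℕ} {a₀ z : CN N} (ha₀ : a₀ ∈ ball N) (hz : z ∈ ball N) :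
    1 - inner ℂ (conjVec a₀) z ≠ 0 := by
  refine one_sub_inner_ne_zero ?_ hz
  rw [mem_ball_zero_iff] at ha₀ ⊢
  rwa [norm_conjVec]

lemma autNum_eq_mul {N : ℕ} {a₀ : CN N} (ha₀ : a₀ ∈ ball N) (A : Matrix (Fin N) (Fin N) ℂ)
    {w z : CN N} (hw : w ∈ ball N) (hz : z ∈ ball N) :
    autNum a₀ A w z = (1 - inner ℂ (conjVec a₀) z) *
      (starRingEnd ℂ) (1 - inner ℂ (conjVec a₀) w) * (1 - inner ℂ (phi a₀ A w) (phi a₀ A z)) := by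
  have h1 := one_sub_inner_conjVec_ne_zero ha₀ hz
  have h2 := one_sub_inner_conjVec_ne_zero ha₀ hw
  have h3 : (starRingEnd ℂ) (1 - inner ℂ (conjVec a₀) w) ≠ 0 :=
    (map_ne_zero _).mpr h2
  rw [phi, phi, inner_smul_left, inner_smul_right, autNum, map_inv₀]
  field_simp

/-- The exponent `N` in `psi` is exactly what cancels the denominators of `phi` inside the kernel.
-/
lemma weighted_szego {N : ℕ} (a₁ : ℂ) {a₀ : CN N} (ha₀ : a₀ ∈ ball N)
    (A : Matrix (Fin N) (Fin N) ℂ) {w z : CN N} (hw : w ∈ ball N) (hz : z ∈ ball N) :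
    psi a₁ a₀ z * (starRingEnd ℂ) (psi a₁ a₀ w) * szego (phi a₀ A w) (phi a₀ A z) =
      a₁ * (starRingEnd ℂ) a₁ * (autNum a₀ A w z ^ N)⁻¹ := by
  rw [autNum_eq_mul ha₀ A hw hz, psi, psi, szego, map_div₀, map_pow, mul_pow, mul_pow, mul_inv,
    mul_inv]
  ring

/-- On the diagonal `w = z` the two formulas for `autNum` express `1 - |φ(z)|²` as a positive
number. This is needed for the conjugate data, that is, for the inverse map. -/
lemma AutRel.mapsTo {N : ℕ} {a₀ : CN N} {A : Matrix (Fin N) (Fin N) ℂ} (h : AutRel a₀ A)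
    (ha₀ : a₀ ∈ ball N) : Set.MapsTo (phi a₀ A) (ball N) (ball N) := by
  intro z hz
  have h1 := one_sub_inner_conjVec_ne_zero ha₀ hz
  have h2 := (autNum_eq_mul ha₀ A hz hz).symm.trans (h.autNum_eq z z)
  rw [Complex.mul_conj', inner_self_eq_norm_sq_to_K, inner_self_eq_norm_sq_to_K] at h2
  have h3 : ‖1 - inner ℂ (conjVec a₀) z‖ ^ 2 * (1 - ‖phi a₀ A z‖ ^ 2) =
      (1 - ‖a₀‖ ^ 2) * (1 - ‖z‖ ^ 2) := by
    apply Complex.ofReal_injective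
    push_cast
    push_cast at h2
    exact h2
  rw [mem_ball_zero_iff] at ha₀ hz ⊢
  have h4 : 0 < 1 - ‖a₀‖ ^ 2 := by nlinarith [norm_nonneg a₀]
  have h5 : 0 < 1 - ‖z‖ ^ 2 := by nlinarith [norm_nonneg z]
  have h6 := mul_pos h4 h5
  rw [← h3] at h6
  have h7 := (mul_pos_iff_of_pos_left (by positivity)).mp h6
  nlinarith [norm_nonneg (phi a₀ A z)]

lemma one_sub_norm_sq_ne_zero {N : ℕ} {a₀ : CN N} (ha₀ : a₀ ∈ ball N) :
    ((1 - ‖a₀‖ ^ 2 : ℝ) : ℂ) ≠ 0 := by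
  rw [mem_ball_zero_iff] at ha₀
  have : 1 - ‖a₀‖ ^ 2 ≠ 0 := by nlinarith [norm_nonneg a₀]
  exact_mod_cast this

/-- The inverse of the automorphism. -/
lemma AutRel.phi_phi {N : ℕ} {a₀ : CN N} {A : Matrix (Fin N) (Fin N) ℂ} (h : AutRel a₀ A)
    (ha₀ : a₀ ∈ ball N) {y : CN N} (hy : y ∈ ball N) :
    phi a₀ A (phi (conjVec a₀) (A.map (starRingEnd ℂ)) y) = y := by
  have hd := one_sub_inner_ne_zero ha₀ hy
  have hc := one_sub_norm_sq_ne_zero ha₀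
  have hmm := h.conj.map_map y
  rw [conjVec_conjVec, norm_conjVec, map_conj_map_conj] at hmm
  have hl := h.conj.inner_left y
  rw [conjVec_conjVec] at hl
  have hn : (inner ℂ (conjVec a₀) (conjVec a₀) : ℂ) = ((‖a₀‖ ^ 2 : ℝ) : ℂ) := by
    rw [inner_self_eq_norm_sq_to_K, norm_conjVec]
    simp
  have hden : 1 - inner ℂ (conjVec a₀) (phi (conjVec a₀) (A.map (starRingEnd ℂ)) y) =
      (1 - inner ℂ a₀ y)⁻¹ * ((1 - ‖a₀‖ ^ 2 : ℝ) : ℂ) := by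
    rw [phi, conjVec_conjVec, inner_smul_right, inner_sub_right, hl, hn]
    push_cast
    field_simp
    ring
  -- The `a₀` terms cancel and leave `y` times the same scalar as in `hden`.
  have hnum : a₀ - Matrix.toEuclideanLin A (phi (conjVec a₀) (A.map (starRingEnd ℂ)) y) =
      ((1 - inner ℂ a₀ y)⁻¹ * ((1 - ‖a₀‖ ^ 2 : ℝ) : ℂ)) • y := by
    rw [phi, conjVec_conjVec, map_smul, map_sub, h.fix, hmm, ← smul_smul]
    have : a₀ = (1 - inner ℂ a₀ y : ℂ)⁻¹ • ((1 - inner ℂ a₀ y : ℂ) • a₀) := by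
      rw [inv_smul_smul₀ hd]
    nth_rewrite 1 [this]
    rw [← smul_sub]
    congr 1
    rw [sub_smul, one_smul]
    abel
  rw [phi, hden, hnum, inv_smul_smul₀ (mul_ne_zero (inv_ne_zero hd) hc)]

lemma AutRel.surjective {N : ℕ} {a₀ : CN N} {A : Matrix (Fin N) (Fin N) ℂ} (h : AutRel a₀ A)
    (ha₀ : a₀ ∈ ball N) (hφ : Set.MapsTo (phi a₀ A) (ball N) (ball N)) :
    Function.Surjective (hφ.restrict _ _ _) := by
  intro y
  have ha : conjVec a₀ ∈ ball N := by
    rw [mem_ball_zero_iff] at ha₀ ⊢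
    rwa [norm_conjVec]
  exact ⟨⟨_, h.conj.mapsTo ha y.2⟩, Subtype.ext (h.phi_phi ha₀ y.2)⟩

/-! ### The relations from the kernel identity -/

/-- Roots of unity prevent taking `n`-th roots directly. The derivatives at `t = 0` agree, and the
common factor `n c^{n-1}` is nonzero. -/
lemma eq_of_pow_eq_near_zero {n : ℕ} (hn : n ≠ 0) {c β γ : ℂ} (hc : c ≠ 0)
    (h : ∀ t : ℂ, ‖t‖ < 1 → (c + t * β) ^ n = c ^ n * (1 - t * γ) ^ n) : β = -(c * γ) := by
  have h1 : HasDerivAt (fun t : ℂ => (c + t * β) ^ n)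
      ((n : ℂ) * (c + 0 * β) ^ (n - 1) * (1 * β)) 0 :=
    (((hasDerivAt_id (0 : ℂ)).mul_const β).const_add c).pow n
  have h2 : HasDerivAt (fun t : ℂ => c ^ n * (1 - t * γ) ^ n)
      (c ^ n * ((n : ℂ) * (1 - 0 * γ) ^ (n - 1) * (-(1 * γ)))) 0 :=
    ((((hasDerivAt_id (0 : ℂ)).mul_const γ).const_sub 1).pow n).const_mul _
  have h3 : (fun t : ℂ => (c + t * β) ^ n) =ᶠ[𝓝 0] fun t => c ^ n * (1 - t * γ) ^ n := by
    filter_upwards [Metric.ball_mem_nhds (0 : ℂ) one_pos] with t ht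
    exact h t (mem_ball_zero_iff.mp ht)
  have h4 := h1.unique (h2.congr_of_eventuallyEq h3)
  obtain ⟨m, rfl⟩ := Nat.exists_eq_succ_of_ne_zero hn
  simp only [zero_mul, add_zero, sub_zero, one_pow, one_mul, mul_one, Nat.succ_eq_add_one,
    Nat.add_sub_cancel] at h4
  have h5 : ((m + 1 : ℕ) : ℂ) * c ^ m ≠ 0 := by
    refine mul_ne_zero ?_ (pow_ne_zero _ hc)
    exact_mod_cast m.succ_ne_zero
  apply mul_left_cancel₀ h5
  rw [h4]
  ring

/-- Along `z ↦ t z` the numerator is affine in `t`. Taking `w = 0` isolates the part linear in `z`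
and yields `fix`; once it vanishes, general `w` isolates the sesquilinear part and yields `mul`. -/
lemma autRel_of_autNum {N : ℕ} [NeZero N] {a₀ : CN N} (ha₀ : a₀ ∈ ball N)
    {A : Matrix (Fin N) (Fin N) ℂ} (hA : A.IsSymm)
    (h : ∀ w ∈ ball N, ∀ z ∈ ball N, autNum a₀ A w z ^ N =
      ((1 - ‖a₀‖ ^ 2 : ℝ) : ℂ) ^ N * (1 - inner ℂ w z) ^ N) : AutRel a₀ A := by
  have hc := one_sub_norm_sq_ne_zero ha₀
  have hsm : ∀ {z : CN N} {t : ℂ}, z ∈ ball N → ‖t‖ < 1 → t • z ∈ ball N := by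
    intro z t hz ht
    rw [mem_ball_zero_iff] at hz ⊢
    rw [norm_smul]
    nlinarith [norm_nonneg z, norm_nonneg t]
  have hlin : ∀ z ∈ ball N,
      inner ℂ a₀ (Matrix.toEuclideanLin A z) - inner ℂ (conjVec a₀) z = 0 := by
    intro z hz
    have := eq_of_pow_eq_near_zero (NeZero.ne N) hc
      (β := inner ℂ a₀ (Matrix.toEuclideanLin A z) - inner ℂ (conjVec a₀) z) (γ := 0) (by
        intro t ht
        have h1 := h 0 (Metric.mem_ball_self one_pos) _ (hsm hz ht)
        rw [autNum_eq_add] at h1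
        simp only [map_zero, inner_zero_right, inner_zero_left, sub_zero, mul_zero, add_zero,
          map_smul, inner_smul_right] at h1
        rw [mul_sub, h1, mul_zero, sub_zero])
    rw [this, mul_zero, neg_zero]
  have hbil : ∀ w ∈ ball N, ∀ z ∈ ball N,
      inner ℂ (conjVec a₀) z * (starRingEnd ℂ) (inner ℂ (conjVec a₀) w) -
        inner ℂ (Matrix.toEuclideanLin A w) (Matrix.toEuclideanLin A z) =
      -(((1 - ‖a₀‖ ^ 2 : ℝ) : ℂ) * inner ℂ w z) := by
    intro w hw z hz
    refine eq_of_pow_eq_near_zero (NeZero.ne N) hc fun t ht => ?_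
    have h1 := h w hw _ (hsm hz ht)
    rw [autNum_eq_add, hlin w hw, hlin _ (hsm hz ht), map_zero, add_zero, add_zero, map_smul,
      inner_smul_right, inner_smul_right, inner_smul_right] at h1
    rw [← h1]
    ring
  -- Basis vectors are halved to lie in the open ball; the two halves account for the factor `4` in
  -- the matrix identity below.
  set e : Fin N → CN N := fun i => (1 / 2 : ℂ) • EuclideanSpace.single i (1 : ℂ) with he
  have hemem : ∀ i, e i ∈ ball N := by
    intro i
    rw [mem_ball_zero_iff, he, norm_smul, PiLp.norm_single]
    norm_num
  have hAe : ∀ i, Matrix.toEuclideanLin A (e i) =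
      (1 / 2 : ℂ) • WithLp.toLp 2 (fun k => A k i) := by
    intro i
    rw [he, map_smul]
    congr 1
    ext k
    simp [Matrix.toLpLin_apply]
  have hce : ∀ i, inner ℂ (conjVec a₀) (e i) = 1 / 2 * a₀ i := by
    intro i
    rw [he, inner_smul_right, EuclideanSpace.inner_single_right]
    simp [conjVec_apply]
  refine ⟨hA, ?_, ?_⟩
  · ext i j
    have h1 := hbil _ (hemem i) _ (hemem j)
    rw [hAe, hAe, hce, hce, inner_smul_left, inner_smul_right, he, inner_smul_left,
      inner_smul_right, EuclideanSpace.inner_single_left] at h1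
    simp only [PiLp.inner_apply, RCLike.inner_apply, map_mul, map_div₀, map_one, map_ofNat,
      PiLp.single_apply] at h1
    simp only [Matrix.sub_apply, Matrix.mul_apply, Matrix.vecMulVec_apply, Matrix.smul_apply,
      Matrix.map_apply, Matrix.one_apply, smul_eq_mul, conjVec_apply]
    have h2 : ∑ k, (starRingEnd ℂ) (A i k) * A k j = ∑ k, A k j * (starRingEnd ℂ) (A k i) :=
      Finset.sum_congr rfl fun k _ => by rw [hA.apply k i, mul_comm]
    rw [h2]
    linear_combination -4 * h1
  · ext j
    have h1 := hlin _ (hemem j)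
    rw [hAe, hce, inner_smul_right, ← mul_sub] at h1
    have h2 := (mul_eq_zero.mp h1).resolve_left (by norm_num)
    rw [sub_eq_zero] at h2
    rw [← h2]
    simp only [Matrix.toLpLin_apply, Matrix.mulVec, dotProduct, PiLp.inner_apply,
      RCLike.inner_apply, conjVec_apply]
    exact Finset.sum_congr rfl fun k _ => by rw [hA.apply k j]

/-! ### Normalization of the weight, the equivalence, and the case `a₀ = 0` -/

lemma rpow_half_sq {x : ℝ} (hx : 0 ≤ x) (N : ℕ) : (x ^ ((N : ℝ) / 2)) ^ 2 = x ^ N := by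
  rw [← Real.rpow_natCast, ← Real.rpow_mul hx, Nat.cast_ofNat, div_mul_cancel₀ _ two_ne_zero,
    Real.rpow_natCast]

lemma one_sub_norm_sq_pos {N : ℕ} {a₀ : CN N} (ha₀ : a₀ ∈ ball N) : 0 < 1 - ‖a₀‖ ^ 2 := by
  rw [mem_ball_zero_iff] at ha₀
  nlinarith [norm_nonneg a₀]

/-- The normalization of the weight: `|a₁|² = (1 - |a₀|²)^N`. -/
lemma exists_unimodular_iff {N : ℕ} {a₁ : ℂ} {a₀ : CN N} (ha₀ : a₀ ∈ ball N) :
    (∃ lam : ℂ, ‖lam‖ = 1 ∧ a₁ = lam * (((1 - ‖a₀‖ ^ 2) ^ ((N : ℝ) / 2) : ℝ) : ℂ)) ↔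
      a₁ * (starRingEnd ℂ) a₁ = ((1 - ‖a₀‖ ^ 2 : ℝ) : ℂ) ^ N := by
  have hc := one_sub_norm_sq_pos ha₀
  set s : ℝ := (1 - ‖a₀‖ ^ 2) ^ ((N : ℝ) / 2) with hs
  have hs0 : 0 < s := Real.rpow_pos_of_pos hc _
  have hs2 : s ^ 2 = (1 - ‖a₀‖ ^ 2) ^ N := rpow_half_sq hc.le N
  rw [Complex.mul_conj', ← Complex.ofReal_pow, ← Complex.ofReal_pow, ← hs2, Complex.ofReal_inj]
  constructor
  · rintro ⟨lam, hl, rfl⟩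
    rw [norm_mul, hl, one_mul, Complex.norm_real, Real.norm_of_nonneg hs0.le]
  · intro h
    have h1 := (pow_left_inj₀ (norm_nonneg _) hs0.le two_ne_zero).mp h
    have hsc : (s : ℂ) ≠ 0 := by exact_mod_cast hs0.ne'
    refine ⟨a₁ / s, ?_, (div_mul_cancel₀ _ hsc).symm⟩
    rw [norm_div, h1, Complex.norm_real, Real.norm_of_nonneg hs0.le, div_self hs0.ne']

lemma isUnitary_iff {N : ℕ} [NeZero N] {a₁ : ℂ} (ha₁ : a₁ ≠ 0) {a₀ : CN N} (ha₀ : a₀ ∈ ball N)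
    {A : Matrix (Fin N) (Fin N) ℂ} (hA : A.IsSymm)
    (hφ : Set.MapsTo (phi a₀ A) (ball N) (ball N)) :
    IsUnitaryOnH2 (fun z => psi a₁ a₀ z) (hφ.restrict _ _ _) ↔
      a₁ * (starRingEnd ℂ) a₁ = ((1 - ‖a₀‖ ^ 2 : ℝ) : ℂ) ^ N ∧ AutRel a₀ A := by
  have hc := one_sub_norm_sq_ne_zero ha₀
  constructor
  · intro hU
    have h1 : ∀ w ∈ ball N, ∀ z ∈ ball N,
        a₁ * (starRingEnd ℂ) a₁ * (autNum a₀ A w z ^ N)⁻¹ = ((1 - inner ℂ w z) ^ N)⁻¹ := by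
      intro w hw z hz
      rw [← weighted_szego a₁ ha₀ A hw hz]
      exact szego_identity_of_isUnitary hU ⟨w, hw⟩ ⟨z, hz⟩
    -- Since `0⁻¹ = 0`, a zero of `autNum ^ N` would make the left side of `h1` vanish, but the
    -- right side never does.
    have hne : ∀ w ∈ ball N, ∀ z ∈ ball N, autNum a₀ A w z ^ N ≠ 0 := by
      intro w hw z hz h0
      have h2 := h1 w hw z hz
      rw [h0, inv_zero, mul_zero] at h2
      exact inv_ne_zero (pow_ne_zero N (one_sub_inner_ne_zero hw hz)) h2.symm
    have h2 : ∀ w ∈ ball N, ∀ z ∈ ball N,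
        autNum a₀ A w z ^ N = a₁ * (starRingEnd ℂ) a₁ * (1 - inner ℂ w z) ^ N := by
      intro w hw z hz
      have h3 := h1 w hw z hz
      have h4 := hne w hw z hz
      have h5 := pow_ne_zero N (one_sub_inner_ne_zero hw hz)
      field_simp at h3
      rw [← h3]
    -- At `w = z = 0` the numerator is `1 - |a₀|²`.
    have hm : a₁ * (starRingEnd ℂ) a₁ = ((1 - ‖a₀‖ ^ 2 : ℝ) : ℂ) ^ N := by
      have h0 : (0 : CN N) ∈ ball N := Metric.mem_ball_self one_pos
      have h3 := h2 0 h0 0 h0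
      rw [autNum_eq_add] at h3
      simpa using h3.symm
    refine ⟨hm, autRel_of_autNum ha₀ hA fun w hw z hz => ?_⟩
    rw [h2 w hw z hz, hm]
  · rintro ⟨hm, hR⟩
    refine isUnitary_of_szego_identity (hR.surjective ha₀ hφ) (fun z => ?_) fun w z => ?_
    · exact div_ne_zero ha₁ (pow_ne_zero _ (one_sub_inner_conjVec_ne_zero ha₀ z.2))
    · refine (weighted_szego a₁ ha₀ A w.2 z.2).trans ?_
      rw [hm, hR.autNum_eq, mul_pow, mul_inv, mul_inv_cancel_left₀ (pow_ne_zero _ hc)]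
      rfl

lemma conjVec_zero {N : ℕ} : conjVec (0 : CN N) = 0 := by
  ext i
  simp [conjVec_apply]

lemma psi_zero {N : ℕ} (a₁ : ℂ) (z : CN N) : psi a₁ 0 z = a₁ := by
  simp [psi, conjVec_zero]

lemma phi_zero {N : ℕ} (A : Matrix (Fin N) (Fin N) ℂ) (z : CN N) :
    phi 0 A z = -Matrix.toEuclideanLin A z := by
  simp [phi, conjVec_zero]

lemma mem_unitaryGroup_iff_of_isSymm {N : ℕ} {A : Matrix (Fin N) (Fin N) ℂ} (hA : A.IsSymm) :
    A ∈ Matrix.unitaryGroup (Fin N) ℂ ↔ A.map (starRingEnd ℂ) * A = 1 := by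
  have h : A.map (starRingEnd ℂ) = star A := by
    rw [Matrix.star_eq_conjTranspose, Matrix.conjTranspose, hA.eq]
    rfl
  rw [Matrix.mem_unitaryGroup_iff', h]

end BallHardy

end

theorem mainTheorem4 {N : ℕ} [NeZero N] (a₁ : ℂ) (ha₁ : a₁ ≠ 0)
    (a₀ : BallHardy.CN N) (ha₀ : a₀ ∈ BallHardy.ball N)
    (A : Matrix (Fin N) (Fin N) ℂ) (hA : A.IsSymm)
    (hφ : Set.MapsTo (BallHardy.phi a₀ A) (BallHardy.ball N) (BallHardy.ball N)) :
    (BallHardy.IsUnitaryOnH2 (fun z => BallHardy.psi a₁ a₀ z) (hφ.restrict _ _ _) ↔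
      (∃ lam : ℂ, ‖lam‖ = 1 ∧ a₁ = lam * (((1 - ‖a₀‖ ^ 2) ^ ((N : ℝ) / 2) : ℝ) : ℂ)) ∧
      A.map (starRingEnd ℂ) * A - Matrix.vecMulVec (BallHardy.conjVec a₀) a₀ =
        ((1 - ‖a₀‖ ^ 2 : ℝ) : ℂ) • (1 : Matrix (Fin N) (Fin N) ℂ) ∧
      Matrix.toEuclideanLin A (BallHardy.conjVec a₀) = a₀) ∧
    (a₀ = 0 →
      (BallHardy.IsUnitaryOnH2 (fun z => BallHardy.psi a₁ a₀ z) (hφ.restrict _ _ _) ↔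
        (∃ lam : ℂ, ‖lam‖ = 1 ∧ ∀ z ∈ BallHardy.ball N, BallHardy.psi a₁ a₀ z = lam) ∧
        (∀ z ∈ BallHardy.ball N, BallHardy.phi a₀ A z = -Matrix.toEuclideanLin A z) ∧
        A ∈ Matrix.unitaryGroup (Fin N) ℂ ∧ A.IsSymm)) := by
  have main : BallHardy.IsUnitaryOnH2 (fun z => BallHardy.psi a₁ a₀ z) (hφ.restrict _ _ _) ↔
      (∃ lam : ℂ, ‖lam‖ = 1 ∧ a₁ = lam * (((1 - ‖a₀‖ ^ 2) ^ ((N : ℝ) / 2) : ℝ) : ℂ)) ∧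
      A.map (starRingEnd ℂ) * A - Matrix.vecMulVec (BallHardy.conjVec a₀) a₀ =
        ((1 - ‖a₀‖ ^ 2 : ℝ) : ℂ) • (1 : Matrix (Fin N) (Fin N) ℂ) ∧
      Matrix.toEuclideanLin A (BallHardy.conjVec a₀) = a₀ := by
    rw [BallHardy.isUnitary_iff ha₁ ha₀ hA hφ, BallHardy.exists_unimodular_iff ha₀]
    exact and_congr_right fun _ => ⟨fun h => ⟨h.mul, h.fix⟩, fun h => ⟨hA, h.1, h.2⟩⟩
  refine ⟨main, ?_⟩
  rintro rfl
  rw [main, BallHardy.mem_unitaryGroup_iff_of_isSymm hA]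
  -- For `a₀ = 0` the weight is the constant `a₁` and the formula for `φ` holds automatically; only
  -- `|a₁| = 1` and the unitarity of `A` remain.
  simp only [BallHardy.psi_zero, BallHardy.phi_zero, BallHardy.conjVec_zero]
  constructor
  · rintro ⟨⟨lam, hl, h1⟩, h2, -⟩
    refine ⟨⟨lam, hl, fun z _ => ?_⟩, fun z _ => trivial, ?_, hA⟩
    · simpa using h1
    · simpa using h2
  · rintro ⟨⟨lam, hl, h1⟩, -, h2, -⟩
    refine ⟨⟨lam, hl, ?_⟩, ?_, map_zero _⟩
    · simpa using h1 0 (Metric.mem_ball_self one_pos)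
    · simpa using h2
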